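/- Let $r\ge 3$ and let $\Delta_{B_r}=\{\pm\epsilon_i\pm\epsilon_j : i\ne j\}\cup\{\pm\epsilon_i\}$ with simple roots $\alpha_i=\epsilon_i-\epsilon_{i+1}$ ($1\le i\le r-1$), $\alpha_r=\epsilon_r$. To these adjoin finitely many long roots, the long root $\mu$ being adjoined $N_\mu\ge 0$ times, $d=\sum_\mu N_\mu$; let $A^{[d]}$ be the $(r+d)\times(r+d)$ matrix with entries $2(\alpha_i,\alpha_j)/(\alpha_i,\alpha_i)$, where $\alpha_i,\alpha_j$ run through the simple and the adjoined roots. For a generalized intersection matrix $M$, $\mathfrak{gim}(M)$ is the complex Lie algebra with generators $e_i,f_i,h_i$ and relations: (R1) $[h_i,e_j]=M_{ij}e_j$, $[h_i,f_j]=-M_{ij}f_j$, $[e_i,f_i]=h_i$; (R2) if $M_{ij}\le 0$: $[e_i,f_j]=0=[f_i,e_j]$ and $(\mathrm{ad}\,e_i)^{-M_{ij}+1}e_j=0=(\mathrm{ad}\,f_i)^{-M_{ij}+1}f_j$; (R3) if $M_{ij}>0$, $i\neq j$: $[e_i,e_j]=0=[f_i,f_j]$ and $(\mathrm{ad}\,e_i)^{M_{ij}+1}f_j=0=(\mathrm{ad}\,f_i)^{M_{ij}+1}e_j$.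 The generators of $\mathfrak{gim}(A^{[d]})$ are written $e_i,f_i,h_i$ ($1\le i\le r$) for the simple roots and $e_{\mu,i},f_{\mu,i},h_{\mu,i}$ ($1\le i\le N_\mu$) for the copies of the adjoined roots $\mu$. Let $\Omega$ be the set of adjoined long roots of the form $\pm(\epsilon_p+\epsilon_{p+1})$ and $\Theta$ the set of the other adjoined long roots. Let $\mathfrak b$ be the unital associative $\mathbb C$-algebra generated by $x_{\omega,i}^{\pm1}$ ($\omega\in\Omega$, $1\le i\le N_\omega$) and $y_{\theta,i}^{\pm1},z_{\theta,i}^{\pm1}$ ($\theta\in\Theta$, $1\le i\le N_\theta$), where $t^{-1}$ is a two-sided inverse of $t$, subject to the relations, for all $p\neq q$ and all copies $i,j,k$ of the adjoined roots concerned, $$y_{\epsilon_p-\epsilon_q,i}\,x_{\epsilon_p+\epsilon_q,j}=x_{\epsilon_p+\epsilon_q,j}\,z_{\epsilon_p-\epsilon_q,i},\qquad y_{\epsilon_p-\epsilon_q,i}\,z_{\epsilon_p+\epsilon_q,j}=y_{\epsilon_p+\epsilon_q,j}\,z_{\epsilon_p-\epsilon_q,i},$$ $$z_{\epsilon_p-\epsilon_q,i}\,x_{-\epsilon_p-\epsilon_q,k}=x_{-\epsilon_p-\epsilon_q,k}\,y_{\epsilon_p-\epsilon_q,i},\qquad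 z_{\epsilon_p-\epsilon_q,i}\,y_{-\epsilon_p-\epsilon_q,k}=z_{-\epsilon_p-\epsilon_q,k}\,y_{\epsilon_p-\epsilon_q,i}$$ (those with $x$ for $\pm(\epsilon_p+\epsilon_q)\in\Omega$, the others for $\pm(\epsilon_p+\epsilon_q)\in\Theta$). Here the indeterminates of the roots $\pm(\epsilon_p+\epsilon_q)$ are those written with $p<q$, and for $p<q$ one reads $x_{\pm(\epsilon_q+\epsilon_p),j}=-x_{\pm(\epsilon_p+\epsilon_q),j}$, $y_{\pm(\epsilon_q+\epsilon_p),j}=-z_{\pm(\epsilon_p+\epsilon_q),j}$, $z_{\pm(\epsilon_q+\epsilon_p),j}=-y_{\pm(\epsilon_p+\epsilon_q),j}$. Let $\eta$ be the $\mathbb{C}$-linear involution (anti-automorphism of period two) of $\mathfrak b$ with $\eta(x_{\omega,i})=x_{\omega,i}$, $\eta(y_{\theta,i})=z_{\theta,i}$, $\eta(z_{\theta,i})=y_{\theta,i}$. Let $G$ be the $(2r+1)\times(2r+1)$ matrix with ones on the antidiagonal and zeros elsewhere, $\mathfrak A=\{M\in \mathrm M_{2r+1}(\mathfrak b): (M^\eta)^tG+GM=0\}$,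 and for $\mu \in \mathbb{Z}\epsilon_1+\dots+\mathbb{Z}\epsilon_r$ let $\mathfrak A_\mu$ be the $\mu$-weight space of $\mathfrak A$ under the diagonal matrices of $\mathrm{so}_{2r+1}(\mathbb C)=\{M\in \mathrm M_{2r+1}(\mathbb C): M^tG+GM=0\}$, where $\epsilon_i$ denotes the $i$-th diagonal entry. With $\Delta=\Delta_{B_r}\cup\{\pm2\epsilon_i\}$ put $\mathrm{so}_{2r+1}(\mathfrak b,\eta,0,0)=\sum_{\mu\in\Delta}\mathfrak A_\mu+\sum_{\mu\in\Delta}[\mathfrak A_\mu,\mathfrak A_{-\mu}]$. For $1\le k,p,q\le r$ and $i'=2r+2-i$ put $$V_k(a)=E_{k,r+1}(a)+E_{r+1,k'}(-\eta(a)),\quad H_k(a)=E_{r+1,k}(a)+E_{k',r+1}(-\eta(a)),$$ $$U_{p,q}(a)=E_{p,q}(a)+E_{q',p'}(-\eta(a)),\quad R_{p,q}(a)=E_{p,q'}(a)+E_{q,p'}(-\eta(a)),\quad L_{p,q}(a)=E_{p',q}(a)+E_{q',p}(-\eta(a)).$$ Then there is a (unique) homomorphism of complex Lie algebras $\varphi:\mathfrak{gim}(A^{[d]})\to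 \mathrm{so}_{2r+1}(\mathfrak b,\eta,0,0)$ such that - $e_i\mapsto U_{i,i+1}(1)$, $f_i\mapsto U_{i+1,i}(1)$, $h_i\mapsto U_{i,i}(1)+U_{i+1,i+1}(-1)$ for $1\le i\le r-1$; - $e_r\mapsto V_r(\sqrt2)$, $f_r\mapsto H_r(\sqrt2)$, $h_r\mapsto U_{r,r}(2)$; - for an adjoined long root $\mu$ and $1\le i\le N_\mu$, with $u=x_{\mu,i}$ if $\mu\in\Omega$ and $u=y_{\mu,i}$ if $\mu\in\Theta$: if $\mu=\epsilon_p-\epsilon_q$ ($p\ne q$), then $e_{\mu,i}\mapsto U_{p,q}(u)$, $f_{\mu,i}\mapsto U_{q,p}(u^{-1})$, $h_{\mu,i}\mapsto U_{p,p}(1)+U_{q,q}(-1)$; if $\mu=\epsilon_p+\epsilon_q$ ($p<q$), then $e_{\mu,i}\mapsto R_{p,q}(u)$, $f_{\mu,i}\mapsto L_{q,p}(u^{-1})$, $h_{\mu,i}\mapsto U_{p,p}(1)+U_{q,q}(1)$; if $\mu=-\epsilon_p-\epsilon_q$ ($p<q$), then $e_{\mu,i}\mapsto L_{p,q}(u)$,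 $f_{\mu,i}\mapsto R_{q,p}(u^{-1})$, $h_{\mu,i}\mapsto U_{p,p}(-1)+U_{q,q}(-1)$. -/

import Mathlib

attribute [local instance 100] LieRing.ofAssociativeRing

namespace GimB

noncomputable section

/-! ### Generalized intersection matrices and their Lie algebras -/

/-- A generalized intersection matrix: integer entries, `2` on the diagonal, and the off-diagonal
entries `M i j` and `M j i` have the same sign. -/
structure IsGIM {ι : Type*} (M : Matrix ι ι ℤ) : Prop where
  diag : ∀ i, M i i = 2
  neg_iff : ∀ i j, i ≠ j → (M i j < 0 ↔ M j i < 0)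
  pos_iff : ∀ i j, i ≠ j → (0 < M i j ↔ 0 < M j i)

/-- The generators `e_i`, `f_i`, `h_i`. -/
inductive GimGen (ι : Type*)
  | e : ι → GimGen ι
  | f : ι → GimGen ι
  | h : ι → GimGen ι

namespace GimGen

variable {ι : Type*}

/-- `e_i` in the free Lie algebra. -/
abbrev E (i : ι) : FreeLieAlgebra ℂ (GimGen ι) := FreeLieAlgebra.of ℂ (GimGen.e i)

/-- `f_i` in the free Lie algebra. -/
abbrev F (i : ι) : FreeLieAlgebra ℂ (GimGen ι) := FreeLieAlgebra.of ℂ (GimGen.f i)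

/-- `h_i` in the free Lie algebra. -/
abbrev H (i : ι) : FreeLieAlgebra ℂ (GimGen ι) := FreeLieAlgebra.of ℂ (GimGen.h i)

end GimGen

open GimGen in
/-- The elements of the free Lie algebra that are set equal to zero in `gim M`. -/
inductive GimRel {ι : Type*} (M : Matrix ι ι ℤ) : FreeLieAlgebra ℂ (GimGen ι) → Prop
  | he (i j : ι) : GimRel M (⁅H i, E j⁆ - M i j • E j)
  | hf (i j : ι) : GimRel M (⁅H i, F j⁆ + M i j • F j)
  | ef (i : ι) : GimRel M (⁅E i, F i⁆ - H i)
  | nonpos_ef (i j : ι) (hM : M i j ≤ 0) : GimRel M ⁅E i, F j⁆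
  | nonpos_fe (i j : ι) (hM : M i j ≤ 0) : GimRel M ⁅F i, E j⁆
  | nonpos_ad_e (i j : ι) (hM : M i j ≤ 0) :
      GimRel M ((LieAlgebra.ad ℂ _ (E i) ^ ((-M i j).toNat + 1)) (E j))
  | nonpos_ad_f (i j : ι) (hM : M i j ≤ 0) :
      GimRel M ((LieAlgebra.ad ℂ _ (F i) ^ ((-M i j).toNat + 1)) (F j))
  | pos_ee (i j : ι) (hM : 0 < M i j) (hij : i ≠ j) : GimRel M ⁅E i, E j⁆
  | pos_ff (i j : ι) (hM : 0 < M i j) (hij : i ≠ j) : GimRel M ⁅F i, F j⁆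
  | pos_ad_e (i j : ι) (hM : 0 < M i j) (hij : i ≠ j) :
      GimRel M ((LieAlgebra.ad ℂ _ (E i) ^ ((M i j).toNat + 1)) (F j))
  | pos_ad_f (i j : ι) (hM : 0 < M i j) (hij : i ≠ j) :
      GimRel M ((LieAlgebra.ad ℂ _ (F i) ^ ((M i j).toNat + 1)) (E j))

/-- The ideal of the free Lie algebra generated by the defining relations. -/
def gimIdeal {ι : Type*} (M : Matrix ι ι ℤ) : LieIdeal ℂ (FreeLieAlgebra ℂ (GimGen ι)) :=
  LieSubmodule.lieSpan ℂ (FreeLieAlgebra ℂ (GimGen ι)) {x | GimRel M x}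

/-- The Lie algebra `gim(M)` over `ℂ` (meaningful when `M` is a generalized intersection
matrix). -/
abbrev gim {ι : Type*} (M : Matrix ι ι ℤ) : Type _ :=
  FreeLieAlgebra ℂ (GimGen ι) ⧸ gimIdeal M

/-- The image of a generator in `gim(M)`. -/
def gimOf {ι : Type*} (M : Matrix ι ι ℤ) (g : GimGen ι) : gim M :=
  LieSubmodule.Quotient.mk (FreeLieAlgebra.of ℂ g)

/-! ### Roots and the multiply affinized Cartan matrix of type `B_r` -/

/-- The vector `ε_i` of `ℤ^r`. -/
def eps {r : ℕ} (i : Fin r) : Fin r → ℤ := Pi.single i 1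

/-- The long roots of `B_r`; each of them occurs exactly once. -/
inductive LongRoot (r : ℕ) : Type
  /-- the root `ε_p - ε_q` with `p ≠ q` -/
  | sub (p q : Fin r) (hpq : p ≠ q) : LongRoot r
  /-- the root `ε_p + ε_q`, written with `p < q` -/
  | add (p q : Fin r) (hpq : p < q) : LongRoot r
  /-- the root `-ε_p - ε_q`, written with `p < q` -/
  | neg (p q : Fin r) (hpq : p < q) : LongRoot r

namespace LongRoot

variable {r : ℕ}

/-- The root as a vector. -/
def vec : LongRoot r → (Fin r → ℤ)
  | sub p q _ => eps p - eps q
  | add p q _ => eps p + eps q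
  | neg p q _ => -eps p - eps q

/-- The long roots of the form `±(ε_p + ε_{p+1})`. -/
def IsOmega : LongRoot r → Prop
  | sub _ _ _ => False
  | add p q _ => (q : ℕ) = p + 1
  | neg p q _ => (q : ℕ) = p + 1

end LongRoot

/-- The simple roots `ε_i - ε_{i+1}` (for all `i` but the last) and `ε_r`. -/
def simpleRoot (r : ℕ) (i : Fin r) : Fin r → ℤ :=
  if h : (i : ℕ) + 1 < r then eps i - eps ⟨i + 1, h⟩ else eps i

/-- The index set of the simple roots followed by the adjoined long roots, where the long root
`μ` is adjoined `N μ` times; its cardinality is `r + d` with `d = ∑ μ, N μ`. -/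
abbrev Idx (r : ℕ) (N : LongRoot r → ℕ) : Type := Fin r ⊕ (Σ μ : LongRoot r, Fin (N μ))

/-- The root attached to an index. -/
def rootOf (r : ℕ) (N : LongRoot r → ℕ) : Idx r N → (Fin r → ℤ)
  | Sum.inl i => simpleRoot r i
  | Sum.inr m => m.1.vec

/-- The matrix `A^[d]` with entries `2 (α_i, α_j) / (α_i, α_i)`. The Killing form is a positive
multiple of the standard inner product, so the quotient may be computed with the latter; the
division is exact, since `(α_i, α_i)` is `1` or `2`. -/
def affMatrix (r : ℕ) (N : LongRoot r → ℕ) : Matrix (Idx r N) (Idx r N) ℤ :=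
  Matrix.of fun i j =>
    2 * (rootOf r N i ⬝ᵥ rootOf r N j) / (rootOf r N i ⬝ᵥ rootOf r N i)

theorem eps_dot {r : ℕ} (i j : Fin r) : eps i ⬝ᵥ eps j = if i = j then 1 else 0 := by
  simp [eps, Pi.single_apply, eq_comm]

theorem rootOf_dot_self (r : ℕ) (N : LongRoot r → ℕ) (i : Idx r N) :
    rootOf r N i ⬝ᵥ rootOf r N i = 1 ∨ rootOf r N i ⬝ᵥ rootOf r N i = 2 := by
  rcases i with i | ⟨⟨p, q, h⟩ | ⟨p, q, h⟩ | ⟨p, q, h⟩, k⟩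
  · by_cases h : (i : ℕ) + 1 < r
    · have : (i : ℕ) ≠ i + 1 := by omega
      right
      simp [rootOf, simpleRoot, h, eps_dot, Fin.ext_iff]
    · left; simp [rootOf, simpleRoot, h, eps_dot]
  · right; simp [rootOf, LongRoot.vec, eps_dot, h, h.symm]
  · right; simp [rootOf, LongRoot.vec, eps_dot, h.ne, h.ne']
  · right; simp [rootOf, LongRoot.vec, eps_dot, h.ne, h.ne']

/-- `A^[d]` is a generalized intersection matrix. -/
theorem isGIM_affMatrix (r : ℕ) (N : LongRoot r → ℕ) : IsGIM (affMatrix r N) where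
  diag i := by
    rcases rootOf_dot_self r N i with h | h <;> simp [affMatrix, h]
  neg_iff i j _ := by
    simp only [affMatrix, Matrix.of_apply, dotProduct_comm (rootOf r N j) (rootOf r N i)]
    rcases rootOf_dot_self r N i with h | h <;> rcases rootOf_dot_self r N j with h' | h' <;>
      rw [h, h'] <;> omega
  pos_iff i j _ := by
    simp only [affMatrix, Matrix.of_apply, dotProduct_comm (rootOf r N j) (rootOf r N i)]
    rcases rootOf_dot_self r N i with h | h <;> rcases rootOf_dot_self r N j with h' | h' <;>
      rw [h, h'] <;> omega

/-- The root system of type `BC_r`. -/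
def rootsBC (r : ℕ) : Set (Fin r → ℤ) :=
  {μ | ∃ i j, i ≠ j ∧ (μ = eps i - eps j ∨ μ = eps i + eps j ∨ μ = -eps i - eps j)} ∪
  {μ | ∃ i, μ = eps i ∨ μ = -eps i ∨ μ = 2 • eps i ∨ μ = -(2 • eps i)}

/-! ### The Lie algebra `so_{2r+1}(A, η, 0, 0)` -/

/-- An involution of a unital associative `ℂ`-algebra: a `ℂ`-linear anti-automorphism of period
two. -/
structure Involution (A : Type*) [Ring A] [Algebra ℂ A] extends A →ₗ[ℂ] A where
  map_mul' : ∀ a b : A, toFun (a * b) = toFun b * toFun a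
  invol' : ∀ a : A, toFun (toFun a) = a

instance (A : Type*) [Ring A] [Algebra ℂ A] : CoeFun (Involution A) (fun _ => A → A) :=
  ⟨fun η => η.toLinearMap⟩

section So

variable (r : ℕ) {A : Type*} [Ring A] [Algebra ℂ A] (η : Involution A)

/-- The matrix `G` with ones on the antidiagonal. -/
def antiDiag (A : Type*) [Ring A] : Matrix (Fin (2 * r + 1)) (Fin (2 * r + 1)) A :=
  Matrix.of fun i j => if j = i.rev then 1 else 0

/-- `(M^η)ᵗ`. -/
def conjT (M : Matrix (Fin (2 * r + 1)) (Fin (2 * r + 1)) A) :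
    Matrix (Fin (2 * r + 1)) (Fin (2 * r + 1)) A := (M.map η).transpose

theorem conjT_mul (M N : Matrix (Fin (2 * r + 1)) (Fin (2 * r + 1)) A) :
    conjT r η (M * N) = conjT r η N * conjT r η M := by
  ext i j
  simp only [conjT, Matrix.transpose_apply, Matrix.map_apply, Matrix.mul_apply, map_sum]
  exact Finset.sum_congr rfl fun k _ => η.map_mul' _ _

theorem conjT_sub (M N : Matrix (Fin (2 * r + 1)) (Fin (2 * r + 1)) A) :
    conjT r η (M - N) = conjT r η M - conjT r η N := by
  ext i j
  simp [conjT]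

/-- The Lie algebra `𝔄` of all `M` with `(M^η)ᵗ G + G M = 0`: this is what the general block
matrix Lie algebra reduces to when the module and the hermitian form are zero. -/
def bigA : LieSubalgebra ℂ (Matrix (Fin (2 * r + 1)) (Fin (2 * r + 1)) A) where
  carrier := {M | conjT r η M * antiDiag r A + antiDiag r A * M = 0}
  zero_mem' := by
    have : conjT r η (0 : Matrix (Fin (2 * r + 1)) (Fin (2 * r + 1)) A) = 0 := by
      ext i j; simp [conjT]
    simp [this]
  add_mem' := by
    intro M N hM hN
    have : conjT r η (M + N) = conjT r η M + conjT r η N := by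
      ext i j; simp [conjT]
    simp only [Set.mem_ofPred_eq] at *
    rw [this, add_mul, mul_add, add_add_add_comm, hM, hN, add_zero]
  smul_mem' := by
    intro c M hM
    have : conjT r η (c • M) = c • conjT r η M := by
      ext i j; simp [conjT]
    simp only [Set.mem_ofPred_eq] at *
    rw [this, smul_mul_assoc, mul_smul_comm, ← smul_add, hM, smul_zero]
  lie_mem' := by
    intro M N hM hN
    change conjT r η M * antiDiag r A + antiDiag r A * M = 0 at hM
    change conjT r η N * antiDiag r A + antiDiag r A * N = 0 at hN
    change conjT r η ⁅M, N⁆ * antiDiag r A + antiDiag r A * ⁅M, N⁆ = 0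
    have hM' := eq_neg_of_add_eq_zero_left hM
    have hN' := eq_neg_of_add_eq_zero_left hN
    rw [LieRing.of_associative_ring_bracket, conjT_sub, conjT_mul, conjT_mul, sub_mul, mul_assoc,
      mul_assoc, hM', hN', mul_neg, mul_neg, ← mul_assoc, ← mul_assoc, hM', hN']
    noncomm_ring

/-- The position of `i` among the first `r` of `2r+1` rows. The position `2r+2-i` of the usual
`1`-based numbering is then `(pos r i).rev`. -/
def pos (i : Fin r) : Fin (2 * r + 1) := ⟨i, by omega⟩

/-- The middle position `r+1` (`1`-based). -/
def mid : Fin (2 * r + 1) := ⟨r, by omega⟩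

/-- The root space `𝔄_μ` of `𝔄` with respect to the Cartan subalgebra `𝔥` of diagonal matrices of
`so_{2r+1}(ℂ)`. These matrices are `diag(d)` with `d` antisymmetric under `j ↦ 2r+2-j`, and
`ε_i` maps `diag(d)` to its `i`-th diagonal entry. -/
def rootSpace (μ : Fin r → ℤ) : Submodule ℂ (Matrix (Fin (2 * r + 1)) (Fin (2 * r + 1)) A) where
  carrier := {T | T ∈ bigA r η ∧ ∀ d : Fin (2 * r + 1) → ℂ, (∀ j, d j.rev = -d j) →
    ⁅Matrix.diagonal (fun j => algebraMap ℂ A (d j)), T⁆ = (∑ i, (μ i : ℂ) * d (pos r i)) • T}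
  zero_mem' := ⟨zero_mem _, fun d _ => by simp⟩
  add_mem' := fun hS hT => ⟨add_mem hS.1 hT.1, fun d hd => by
    rw [lie_add, hS.2 d hd, hT.2 d hd, smul_add]⟩
  smul_mem' := fun c T hT => ⟨(bigA r η).smul_mem c hT.1, fun d hd => by
    rw [lie_smul, hT.2 d hd, smul_comm]⟩

/-- The linear span `[𝔄_μ, 𝔄_{-μ}]` of the brackets. -/
def rootBracket (μ : Fin r → ℤ) : Submodule ℂ (Matrix (Fin (2 * r + 1)) (Fin (2 * r + 1)) A) :=
  Submodule.span ℂ {T | ∃ X ∈ rootSpace r η μ, ∃ Y ∈ rootSpace r η (-μ), T = ⁅X, Y⁆}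

/-- The subspace `∑_{μ ∈ Δ} 𝔄_μ + ∑_{μ ∈ Δ} [𝔄_μ, 𝔄_{-μ}]`. -/
def soSubmodule : Submodule ℂ (Matrix (Fin (2 * r + 1)) (Fin (2 * r + 1)) A) :=
  (⨆ μ ∈ rootsBC r, rootSpace r η μ) ⊔ ⨆ μ ∈ rootsBC r, rootBracket r η μ

variable {r} {η}

theorem lie_mem_rootSpace {μ ν : Fin r → ℤ}
    {X Y : Matrix (Fin (2 * r + 1)) (Fin (2 * r + 1)) A}
    (hX : X ∈ rootSpace r η μ) (hY : Y ∈ rootSpace r η ν) : ⁅X, Y⁆ ∈ rootSpace r η (μ + ν) := by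
  refine ⟨(bigA r η).lie_mem hX.1 hY.1, fun d hd => ?_⟩
  rw [leibniz_lie, hX.2 d hd, hY.2 d hd, smul_lie, lie_smul, ← add_smul]
  congr 1
  simp [add_mul, Finset.sum_add_distrib]

/-- The weight of the `j`-th coordinate vector. -/
def wt (r : ℕ) (j : Fin (2 * r + 1)) : Fin r → ℤ := fun k =>
  (if j = pos r k then 1 else 0) - (if j.rev = pos r k then 1 else 0)

theorem wt_cases (j : Fin (2 * r + 1)) :
    wt r j = 0 ∨ ∃ i, wt r j = eps i ∨ wt r j = -eps i := by
  rcases lt_trichotomy (j : ℕ) r with h | h | h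
  · right
    refine ⟨⟨j, h⟩, Or.inl ?_⟩
    ext k
    simp only [wt, pos, eps, Pi.single_apply, Fin.ext_iff, Fin.val_rev]
    split_ifs <;> omega
  · left
    ext k
    have := k.2
    simp only [wt, pos, Fin.ext_iff, Fin.val_rev, Pi.zero_apply]
    split_ifs <;> omega
  · right
    refine ⟨⟨2 * r - j, by omega⟩, Or.inr ?_⟩
    ext k
    have := k.2
    simp only [wt, pos, eps, Pi.single_apply, Pi.neg_apply, Fin.ext_iff, Fin.val_rev]
    split_ifs <;> omega

theorem wt_sub_mem (i j : Fin (2 * r + 1)) :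
    wt r i - wt r j = 0 ∨ wt r i - wt r j ∈ rootsBC r := by
  have key : ∀ a b : Fin r, a = b ∨ a ≠ b := fun a b => eq_or_ne a b
  rcases wt_cases i with hi | ⟨a, hi | hi⟩ <;> rcases wt_cases j with hj | ⟨b, hj | hj⟩ <;>
    rw [hi, hj]
  · left; simp
  · right; right; exact ⟨b, Or.inr (Or.inl (by simp))⟩
  · right; right; exact ⟨b, Or.inl (by simp)⟩
  · right; right; exact ⟨a, Or.inl (by simp)⟩
  · rcases key a b with rfl | h
    · left; simp
    · right; left; exact ⟨a, b, h, Or.inl rfl⟩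
  · right
    rcases key a b with rfl | h
    · right; exact ⟨a, Or.inr (Or.inr (Or.inl (by rw [sub_neg_eq_add, two_smul])))⟩
    · left; exact ⟨a, b, h, Or.inr (Or.inl (by rw [sub_neg_eq_add]))⟩
  · right; right; exact ⟨a, Or.inr (Or.inl (by simp))⟩
  · right
    rcases key a b with rfl | h
    · right; exact ⟨a, Or.inr (Or.inr (Or.inr (by rw [two_smul]; abel)))⟩
    · left; exact ⟨a, b, h, Or.inr (Or.inr rfl)⟩
  · rcases key a b with rfl | h
    · left; simp
    · right; left; exact ⟨b, a, h.symm, Or.inl (by abel)⟩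

theorem rootSpace_eq_zero {μ : Fin r → ℤ} (h0 : μ ≠ 0) (hμ : μ ∉ rootsBC r)
    {T : Matrix (Fin (2 * r + 1)) (Fin (2 * r + 1)) A} (hT : T ∈ rootSpace r η μ) : T = 0 := by
  ext i j
  by_contra hne
  have hne' : T i j ≠ 0 := hne
  have hw : μ = wt r i - wt r j := by
    ext k
    have h := hT.2 (fun l => (wt r l k : ℂ)) (fun l => by simp [wt, Fin.rev_rev])
    have h1 := congrFun (congrFun h i) j
    rw [LieRing.of_associative_ring_bracket, Matrix.sub_apply, Matrix.diagonal_mul,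
      Matrix.mul_diagonal, Matrix.smul_apply, ← Algebra.commutes, ← sub_mul, ← map_sub,
      ← Algebra.smul_def] at h1
    have h2 := smul_left_injective ℂ hne' h1
    have h3 : ∀ l : Fin r, wt r (pos r l) k = if l = k then 1 else 0 := by
      intro l
      have := l.2
      have := k.2
      simp only [wt, pos, Fin.ext_iff, Fin.val_rev]
      split_ifs <;> omega
    have h4 : ((wt r i k - wt r j k : ℤ) : ℂ) = ((μ k : ℤ) : ℂ) := by
      simpa [h3] using h2
    exact_mod_cast h4.symm
  rcases wt_sub_mem i j with h | h
  · exact h0 (hw.trans h)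
  · exact hμ (hw ▸ h)

theorem rootSpace_le_so {μ : Fin r → ℤ} (hμ : μ ∈ rootsBC r) :
    rootSpace r η μ ≤ soSubmodule r η :=
  le_sup_of_le_left (le_iSup₂_of_le μ hμ le_rfl)

theorem rootBracket_le_so {μ : Fin r → ℤ} (hμ : μ ∈ rootsBC r) :
    rootBracket r η μ ≤ soSubmodule r η :=
  le_sup_of_le_right (le_iSup₂_of_le μ hμ le_rfl)

theorem rootBracket_le_rootSpace_zero (μ : Fin r → ℤ) :
    rootBracket r η μ ≤ rootSpace r η 0 := by
  refine Submodule.span_le.2 ?_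
  rintro T ⟨X, hX, Y, hY, rfl⟩
  have := lie_mem_rootSpace hX hY
  rwa [add_neg_cancel] at this

theorem lie_zero_rootBracket {μ : Fin r → ℤ}
    {S T : Matrix (Fin (2 * r + 1)) (Fin (2 * r + 1)) A}
    (hS : S ∈ rootSpace r η 0) (hT : T ∈ rootBracket r η μ) : ⁅S, T⁆ ∈ rootBracket r η μ := by
  induction hT using Submodule.span_induction with
  | mem T h =>
    obtain ⟨X, hX, Y, hY, rfl⟩ := h
    rw [leibniz_lie]
    refine add_mem (Submodule.subset_span ⟨_, ?_, _, hY, rfl⟩)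
      (Submodule.subset_span ⟨_, hX, _, ?_, rfl⟩)
    · simpa using lie_mem_rootSpace hS hX
    · simpa using lie_mem_rootSpace hS hY
  | zero => simp
  | add x y _ _ hx hy => rw [lie_add]; exact add_mem hx hy
  | smul c x _ hx => rw [lie_smul]; exact Submodule.smul_mem _ c hx

theorem so_lie_mem {S T : Matrix (Fin (2 * r + 1)) (Fin (2 * r + 1)) A}
    (hS : S ∈ soSubmodule r η) (hT : T ∈ soSubmodule r η) : ⁅S, T⁆ ∈ soSubmodule r η := by
  have split : ∀ (P : Matrix (Fin (2 * r + 1)) (Fin (2 * r + 1)) A → Prop),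
      P 0 → (∀ x y, P x → P y → P (x + y)) →
      (∀ μ ∈ rootsBC r, ∀ x ∈ rootSpace r η μ, P x) →
      (∀ μ ∈ rootsBC r, ∀ x ∈ rootBracket r η μ, P x) →
      ∀ x ∈ soSubmodule r η, P x := by
    intro P h0 hadd h1 h2 x hx
    obtain ⟨y, hy, z, hz, rfl⟩ := Submodule.mem_sup.1 hx
    refine hadd _ _ ?_ ?_
    · refine Submodule.iSup_induction _ (motive := P) hy (fun μ w hw => ?_) h0 hadd
      exact Submodule.iSup_induction _ (motive := P) hw (fun hμ v hv => h1 μ hμ v hv) h0 hadd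
    · refine Submodule.iSup_induction _ (motive := P) hz (fun μ w hw => ?_) h0 hadd
      exact Submodule.iSup_induction _ (motive := P) hw (fun hμ v hv => h2 μ hμ v hv) h0 hadd
  revert T
  refine split (fun S => ∀ {T}, T ∈ soSubmodule r η → ⁅S, T⁆ ∈ soSubmodule r η) ?_ ?_ ?_ ?_ S hS
  · intro T _; simp
  · intro x y hx hy T hT; rw [add_lie]; exact add_mem (hx hT) (hy hT)
  · intro μ hμ x hx T hT
    refine split (fun T => ⁅x, T⁆ ∈ soSubmodule r η) (by simp)
      (fun a b ha hb => by rw [lie_add]; exact add_mem ha hb) ?_ ?_ T hT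
    · intro ν hν y hy
      by_cases h0 : μ + ν = 0
      · obtain rfl : ν = -μ := (neg_eq_of_add_eq_zero_right h0).symm
        exact rootBracket_le_so hμ (Submodule.subset_span ⟨x, hx, y, hy, rfl⟩)
      · by_cases h1 : μ + ν ∈ rootsBC r
        · exact rootSpace_le_so h1 (lie_mem_rootSpace hx hy)
        · rw [rootSpace_eq_zero h0 h1 (lie_mem_rootSpace hx hy)]; exact zero_mem _
    · intro ν hν y hy
      have := lie_mem_rootSpace hx (rootBracket_le_rootSpace_zero ν hy)
      rw [add_zero] at this
      exact rootSpace_le_so hμ this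
  · intro μ hμ x hx T hT
    have hx0 := rootBracket_le_rootSpace_zero μ hx
    refine split (fun T => ⁅x, T⁆ ∈ soSubmodule r η) (by simp)
      (fun a b ha hb => by rw [lie_add]; exact add_mem ha hb) ?_ ?_ T hT
    · intro ν hν y hy
      have := lie_mem_rootSpace hx0 hy
      rw [zero_add] at this
      exact rootSpace_le_so hν this
    · intro ν hν y hy
      exact rootBracket_le_so hν (lie_zero_rootBracket hx0 hy)

variable (r) (η)

/-- The Lie algebra `so_{2r+1}(A, η, 0, 0) = ∑_{μ ∈ Δ} 𝔄_μ + ∑_{μ ∈ Δ} [𝔄_μ, 𝔄_{-μ}]`. -/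
def so : LieSubalgebra ℂ (Matrix (Fin (2 * r + 1)) (Fin (2 * r + 1)) A) where
  toSubmodule := soSubmodule r η
  lie_mem' := so_lie_mem

/-- `E_{k,r+1}(a) + E_{r+1,2r+2-k}(-η(a))`. -/
def Evert (k : Fin r) (a : A) : Matrix (Fin (2 * r + 1)) (Fin (2 * r + 1)) A :=
  Matrix.single (pos r k) (mid r) a + Matrix.single (mid r) (pos r k).rev (-η a)

/-- `E_{r+1,k}(a) + E_{2r+2-k,r+1}(-η(a))`. -/
def Ehort (k : Fin r) (a : A) : Matrix (Fin (2 * r + 1)) (Fin (2 * r + 1)) A :=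
  Matrix.single (mid r) (pos r k) a + Matrix.single (pos r k).rev (mid r) (-η a)

/-- `E_{p,q}(a) + E_{2r+2-q,2r+2-p}(-η(a))`. -/
def EUL (p q : Fin r) (a : A) : Matrix (Fin (2 * r + 1)) (Fin (2 * r + 1)) A :=
  Matrix.single (pos r p) (pos r q) a + Matrix.single (pos r q).rev (pos r p).rev (-η a)

/-- `E_{p,2r+2-q}(a) + E_{q,2r+2-p}(-η(a))`. -/
def EUR (p q : Fin r) (a : A) : Matrix (Fin (2 * r + 1)) (Fin (2 * r + 1)) A :=
  Matrix.single (pos r p) (pos r q).rev a + Matrix.single (pos r q) (pos r p).rev (-η a)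

/-- `E_{2r+2-p,q}(a) + E_{2r+2-q,p}(-η(a))`. -/
def EBL (p q : Fin r) (a : A) : Matrix (Fin (2 * r + 1)) (Fin (2 * r + 1)) A :=
  Matrix.single (pos r p).rev (pos r q) a + Matrix.single (pos r q).rev (pos r p) (-η a)

end So

/-! ### The coordinate algebra `𝔟` and its involution -/

/-- The indeterminates `x, x⁻¹` for the adjoined long roots `±(ε_p + ε_{p+1})` and
`y, y⁻¹, z, z⁻¹` for the other adjoined long roots. -/
inductive CoordGen {r : ℕ} (N : LongRoot r → ℕ) : Type
  | x (ω : LongRoot r) (h : ω.IsOmega) (i : Fin (N ω)) : CoordGen N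
  | xinv (ω : LongRoot r) (h : ω.IsOmega) (i : Fin (N ω)) : CoordGen N
  | y (θ : LongRoot r) (h : ¬θ.IsOmega) (i : Fin (N θ)) : CoordGen N
  | yinv (θ : LongRoot r) (h : ¬θ.IsOmega) (i : Fin (N θ)) : CoordGen N
  | z (θ : LongRoot r) (h : ¬θ.IsOmega) (i : Fin (N θ)) : CoordGen N
  | zinv (θ : LongRoot r) (h : ¬θ.IsOmega) (i : Fin (N θ)) : CoordGen N

section Coord

variable {r : ℕ} (N : LongRoot r → ℕ)

open LongRoot CoordGen

local notation "ι'" => FreeAlgebra.ι ℂ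

/-- The defining relations of `𝔟`. The first six say that the indeterminates are invertible. The
others come in pairs, one for the root `ε_p - ε_q` and one for the root `ε_q - ε_p`, where `p < q`
throughout. The two relations of a pair are the same relation up to the exchange of `p` and `q`,
with the convention `y_{±(ε_q + ε_p)} = -z_{±(ε_p + ε_q)}`, `z_{±(ε_q + ε_p)} = -y_{±(ε_p + ε_q)}`,
`x_{±(ε_q + ε_p)} = -x_{±(ε_p + ε_q)}` that is forced by `EUR q p a = EUR p q (-η a)` and
`EBL q p a = EBL p q (-η a)`. -/
inductive CoordRel : FreeAlgebra ℂ (CoordGen N) → FreeAlgebra ℂ (CoordGen N) → Prop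
  | x_mul_inv (ω : LongRoot r) (h : ω.IsOmega) (i : Fin (N ω)) :
      CoordRel (ι' (x ω h i) * ι' (xinv ω h i)) 1
  | x_inv_mul (ω : LongRoot r) (h : ω.IsOmega) (i : Fin (N ω)) :
      CoordRel (ι' (xinv ω h i) * ι' (x ω h i)) 1
  | y_mul_inv (θ : LongRoot r) (h : ¬θ.IsOmega) (i : Fin (N θ)) :
      CoordRel (ι' (y θ h i) * ι' (yinv θ h i)) 1
  | y_inv_mul (θ : LongRoot r) (h : ¬θ.IsOmega) (i : Fin (N θ)) :
      CoordRel (ι' (yinv θ h i) * ι' (y θ h i)) 1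
  | z_mul_inv (θ : LongRoot r) (h : ¬θ.IsOmega) (i : Fin (N θ)) :
      CoordRel (ι' (z θ h i) * ι' (zinv θ h i)) 1
  | z_inv_mul (θ : LongRoot r) (h : ¬θ.IsOmega) (i : Fin (N θ)) :
      CoordRel (ι' (zinv θ h i) * ι' (z θ h i)) 1
  | add_omega (p q : Fin r) (hpq : p < q) (h : (add p q hpq).IsOmega)
      (i : Fin (N (sub p q hpq.ne))) (j : Fin (N (add p q hpq))) :
      CoordRel (ι' (y (sub p q hpq.ne) id i) * ι' (x (add p q hpq) h j))
        (ι' (x (add p q hpq) h j) * ι' (z (sub p q hpq.ne) id i))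
  | add_omega' (p q : Fin r) (hpq : p < q) (h : (add p q hpq).IsOmega)
      (i : Fin (N (sub q p hpq.ne'))) (j : Fin (N (add p q hpq))) :
      CoordRel (ι' (y (sub q p hpq.ne') id i) * ι' (x (add p q hpq) h j))
        (ι' (x (add p q hpq) h j) * ι' (z (sub q p hpq.ne') id i))
  | add_theta (p q : Fin r) (hpq : p < q) (h : ¬(add p q hpq).IsOmega)
      (i : Fin (N (sub p q hpq.ne))) (j : Fin (N (add p q hpq))) :
      CoordRel (ι' (y (sub p q hpq.ne) id i) * ι' (z (add p q hpq) h j))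
        (ι' (y (add p q hpq) h j) * ι' (z (sub p q hpq.ne) id i))
  | add_theta' (p q : Fin r) (hpq : p < q) (h : ¬(add p q hpq).IsOmega)
      (i : Fin (N (sub q p hpq.ne'))) (j : Fin (N (add p q hpq))) :
      CoordRel (ι' (y (sub q p hpq.ne') id i) * ι' (y (add p q hpq) h j))
        (ι' (z (add p q hpq) h j) * ι' (z (sub q p hpq.ne') id i))
  | neg_omega (p q : Fin r) (hpq : p < q) (h : (neg p q hpq).IsOmega)
      (i : Fin (N (sub p q hpq.ne))) (k : Fin (N (neg p q hpq))) :
      CoordRel (ι' (z (sub p q hpq.ne) id i) * ι' (x (neg p q hpq) h k))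
        (ι' (x (neg p q hpq) h k) * ι' (y (sub p q hpq.ne) id i))
  | neg_omega' (p q : Fin r) (hpq : p < q) (h : (neg p q hpq).IsOmega)
      (i : Fin (N (sub q p hpq.ne'))) (k : Fin (N (neg p q hpq))) :
      CoordRel (ι' (z (sub q p hpq.ne') id i) * ι' (x (neg p q hpq) h k))
        (ι' (x (neg p q hpq) h k) * ι' (y (sub q p hpq.ne') id i))
  | neg_theta (p q : Fin r) (hpq : p < q) (h : ¬(neg p q hpq).IsOmega)
      (i : Fin (N (sub p q hpq.ne))) (k : Fin (N (neg p q hpq))) :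
      CoordRel (ι' (z (sub p q hpq.ne) id i) * ι' (y (neg p q hpq) h k))
        (ι' (z (neg p q hpq) h k) * ι' (y (sub p q hpq.ne) id i))
  | neg_theta' (p q : Fin r) (hpq : p < q) (h : ¬(neg p q hpq).IsOmega)
      (i : Fin (N (sub q p hpq.ne'))) (k : Fin (N (neg p q hpq))) :
      CoordRel (ι' (z (sub q p hpq.ne') id i) * ι' (z (neg p q hpq) h k))
        (ι' (y (neg p q hpq) h k) * ι' (y (sub q p hpq.ne') id i))

/-- The unital associative `ℂ`-algebra `𝔟`. -/
abbrev CoordAlg : Type := RingQuot (CoordRel N)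

/-- The image of an indeterminate in `𝔟`. -/
def gen (g : CoordGen N) : CoordAlg N := RingQuot.mkAlgHom ℂ (CoordRel N) (FreeAlgebra.ι ℂ g)

/-- The involution on the indeterminates: it fixes `x` and exchanges `y` and `z`. -/
def swapGen : CoordGen N → CoordGen N
  | x ω h i => x ω h i
  | xinv ω h i => xinv ω h i
  | y θ h i => z θ h i
  | yinv θ h i => zinv θ h i
  | z θ h i => y θ h i
  | zinv θ h i => yinv θ h i

theorem gen_rel {a b : FreeAlgebra ℂ (CoordGen N)} (h : CoordRel N a b) :
    RingQuot.mkAlgHom ℂ (CoordRel N) a = RingQuot.mkAlgHom ℂ (CoordRel N) b :=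
  RingQuot.mkAlgHom_rel ℂ h

/-- The involution of `𝔟` as a homomorphism to the opposite algebra. -/
def etaHom : CoordAlg N →ₐ[ℂ] (CoordAlg N)ᵐᵒᵖ :=
  RingQuot.liftAlgHom ℂ ⟨FreeAlgebra.lift ℂ fun g => MulOpposite.op (gen N (swapGen N g)), by
    intro a b h
    cases h with
    | x_mul_inv ω h i =>
      simpa [swapGen, gen, ← MulOpposite.op_mul] using gen_rel N (.x_inv_mul ω h i)
    | x_inv_mul ω h i =>
      simpa [swapGen, gen, ← MulOpposite.op_mul] using gen_rel N (.x_mul_inv ω h i)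
    | y_mul_inv θ h i =>
      simpa [swapGen, gen, ← MulOpposite.op_mul] using gen_rel N (.z_inv_mul θ h i)
    | y_inv_mul θ h i =>
      simpa [swapGen, gen, ← MulOpposite.op_mul] using gen_rel N (.z_mul_inv θ h i)
    | z_mul_inv θ h i =>
      simpa [swapGen, gen, ← MulOpposite.op_mul] using gen_rel N (.y_inv_mul θ h i)
    | z_inv_mul θ h i =>
      simpa [swapGen, gen, ← MulOpposite.op_mul] using gen_rel N (.y_mul_inv θ h i)
    | add_omega p q hpq h i j =>
      simpa [swapGen, gen, ← MulOpposite.op_mul] using (gen_rel N (.add_omega p q hpq h i j)).symm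
    | add_omega' p q hpq h i j =>
      simpa [swapGen, gen, ← MulOpposite.op_mul] using (gen_rel N (.add_omega' p q hpq h i j)).symm
    | add_theta p q hpq h i j =>
      simpa [swapGen, gen, ← MulOpposite.op_mul] using (gen_rel N (.add_theta p q hpq h i j)).symm
    | add_theta' p q hpq h i j =>
      simpa [swapGen, gen, ← MulOpposite.op_mul] using (gen_rel N (.add_theta' p q hpq h i j)).symm
    | neg_omega p q hpq h i j =>
      simpa [swapGen, gen, ← MulOpposite.op_mul] using (gen_rel N (.neg_omega p q hpq h i j)).symm
    | neg_omega' p q hpq h i j =>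
      simpa [swapGen, gen, ← MulOpposite.op_mul] using (gen_rel N (.neg_omega' p q hpq h i j)).symm
    | neg_theta p q hpq h i j =>
      simpa [swapGen, gen, ← MulOpposite.op_mul] using (gen_rel N (.neg_theta p q hpq h i j)).symm
    | neg_theta' p q hpq h i j =>
      simpa [swapGen, gen, ← MulOpposite.op_mul] using
        (gen_rel N (.neg_theta' p q hpq h i j)).symm⟩

theorem etaHom_gen (g : CoordGen N) :
    etaHom N (gen N g) = MulOpposite.op (gen N (swapGen N g)) := by
  simp [etaHom, gen, RingQuot.liftAlgHom_mkAlgHom_apply]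

theorem swapGen_swapGen (g : CoordGen N) : swapGen N (swapGen N g) = g := by
  cases g <;> rfl

theorem etaHom_etaHom (a : CoordAlg N) :
    (etaHom N (etaHom N a).unop).unop = a := by
  have h : ((AlgEquiv.opOp ℂ (CoordAlg N)).symm.toAlgHom.comp
      ((AlgHom.op (etaHom N)).comp (etaHom N))) = AlgHom.id ℂ (CoordAlg N) := by
    apply RingQuot.ringQuot_ext'
    apply FreeAlgebra.hom_ext
    funext g
    have h1 : etaHom N ((RingQuot.mkAlgHom ℂ (CoordRel N)) (FreeAlgebra.ι ℂ g)) =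
      MulOpposite.op (gen N (swapGen N g)) := etaHom_gen N g
    simp [h1, etaHom_gen, swapGen_swapGen]
    rfl
  exact DFunLike.congr_fun h a

/-- The involution `η` of `𝔟`, the one with `η x = x`, `η y = z`, `η z = y`. -/
def eta : Involution (CoordAlg N) where
  toLinearMap := (MulOpposite.opLinearEquiv ℂ).symm.toLinearMap.comp (etaHom N).toLinearMap
  map_mul' a b := by simp
  invol' a := etaHom_etaHom N a

theorem eta_gen (g : CoordGen N) : eta N (gen N g) = gen N (swapGen N g) :=
  congrArg MulOpposite.unop (etaHom_gen N g)

/-! ### The images of the generators -/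

open Classical in
/-- The indeterminate `x_{μ,i}` or `y_{μ,i}`, as the case may be. -/
def coord (μ : LongRoot r) (i : Fin (N μ)) : CoordAlg N :=
  if h : μ.IsOmega then gen N (x μ h i) else gen N (y μ h i)

open Classical in
/-- The indeterminate `x_{μ,i}⁻¹` or `y_{μ,i}⁻¹`, as the case may be. -/
def coordInv (μ : LongRoot r) (i : Fin (N μ)) : CoordAlg N :=
  if h : μ.IsOmega then gen N (xinv μ h i) else gen N (yinv μ h i)

/-- `√2` as an element of `𝔟`. -/
def sqrtTwo : CoordAlg N := algebraMap ℂ (CoordAlg N) (Real.sqrt 2 : ℝ)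

/-- The image of `e_i` or of `e_{μ,i}`. -/
def eImg : Idx r N → Matrix (Fin (2 * r + 1)) (Fin (2 * r + 1)) (CoordAlg N)
  | Sum.inl i =>
      if h : (i : ℕ) + 1 < r then EUL r (eta N) i ⟨i + 1, h⟩ 1
      else Evert r (eta N) i (sqrtTwo N)
  | Sum.inr ⟨sub p q h, i⟩ => EUL r (eta N) p q (coord N (sub p q h) i)
  | Sum.inr ⟨add p q h, i⟩ => EUR r (eta N) p q (coord N (add p q h) i)
  | Sum.inr ⟨neg p q h, i⟩ => EBL r (eta N) p q (coord N (neg p q h) i)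

/-- The image of `f_i` or of `f_{μ,i}`. -/
def fImg : Idx r N → Matrix (Fin (2 * r + 1)) (Fin (2 * r + 1)) (CoordAlg N)
  | Sum.inl i =>
      if h : (i : ℕ) + 1 < r then EUL r (eta N) ⟨i + 1, h⟩ i 1
      else Ehort r (eta N) i (sqrtTwo N)
  | Sum.inr ⟨sub p q h, i⟩ => EUL r (eta N) q p (coordInv N (sub p q h) i)
  | Sum.inr ⟨add p q h, i⟩ => EBL r (eta N) q p (coordInv N (add p q h) i)
  | Sum.inr ⟨neg p q h, i⟩ => EUR r (eta N) q p (coordInv N (neg p q h) i)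

/-- The image of `h_i` or of `h_{μ,i}`. -/
def hImg : Idx r N → Matrix (Fin (2 * r + 1)) (Fin (2 * r + 1)) (CoordAlg N)
  | Sum.inl i =>
      if h : (i : ℕ) + 1 < r then
        EUL r (eta N) i i 1 + EUL r (eta N) ⟨i + 1, h⟩ ⟨i + 1, h⟩ (-1)
      else EUL r (eta N) i i 2
  | Sum.inr ⟨sub p q _, _⟩ => EUL r (eta N) p p 1 + EUL r (eta N) q q (-1)
  | Sum.inr ⟨add p q _, _⟩ => EUL r (eta N) p p 1 + EUL r (eta N) q q 1
  | Sum.inr ⟨neg p q _, _⟩ => EUL r (eta N) p p (-1) + EUL r (eta N) q q (-1)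

end Coord

end

end GimB

/-! The images of `e_i` and `f_i` are weight vectors of weights `α_i` and `-α_i`, and a weight space
of `𝔄` vanishes unless its weight is zero or a root of `BC_r`. Most relations therefore follow from
a length computation. Roots of `BC_r` have squared length 1, 2 or 4, and 4 only for `±2ε_k`, whose
coordinates are even. The roots `α_i` have squared length 1 or 2, and only one index carries a short
root. When the matrix entry is nonzero, each weight occurring in (R2) and (R3) for two distinct
indices has squared length at least 5 (`nonRoot_reflection` for the iterated brackets), so the
element vanishes (`NonRoot.eq_zero`).

Relation (R1) is also formal. The image of `h_i` is the diagonal matrix of the coroot of `α_i`,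
which acts on a weight space by the pairing with the weight (`lie_corootDiag`), and `[e_i, f_i] =
h_i` is a matrix computation with mutually inverse coefficients.

What remains is orthogonal roots, where all four brackets between `e_i, f_i` and `e_j, f_j` must
vanish (`commutingPairs_of_orthogonal`). Sum and difference have squared length 3, or 4 if both
roots are long; in the latter case weights still suffice unless all coordinates are even. The
exception is `ε_p - ε_q` against `±(ε_p + ε_q)`, whose sum and difference are of the form `±2ε_k`.
Here the brackets vanish exactly when the coefficients satisfy a twisted commutation rule such as `a
η(u) = u η(a)`. For adjoined `ε_p - ε_q` this rule is a defining relation of `𝔟`; for a simple root,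
where `a = 1`, it says `η(u) = u`, which is why the indeterminates of `Ω` are fixed by `η`. One of
the four rules implies the other three by inverting units (`units_intertwine`).

Uniqueness holds because the generators generate `gim`. -/

namespace GimB

noncomputable section

/-! ### Lie algebra generalities -/

theorem lieHom_ad_pow {R L L' : Type*} [CommRing R] [LieRing L] [LieAlgebra R L] [LieRing L']
    [LieAlgebra R L'] (f : L →ₗ⁅R⁆ L') (x y : L) (n : ℕ) :
    f ((LieAlgebra.ad R L x ^ n) y) = (LieAlgebra.ad R L' (f x) ^ n) (f y) := by
  induction n with
  | zero => simp
  | succ n ih => simp [pow_succ', ih]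

/-- The homomorphism induced on the quotient by an ideal contained in the kernel. -/
def quotientLift {R L L' : Type*} [CommRing R] [LieRing L] [LieAlgebra R L] [LieRing L']
    [LieAlgebra R L'] (I : LieIdeal R L) (f : L →ₗ⁅R⁆ L') (h : ∀ x ∈ I, f x = 0) :
    (L ⧸ I) →ₗ⁅R⁆ L' where
  toLinearMap := Submodule.liftQ (I : Submodule R L) (f : L →ₗ[R] L') fun x hx => h x hx
  map_lie' := by
    intro x y
    obtain ⟨x, rfl⟩ := LieSubmodule.Quotient.surjective_mk' I x
    obtain ⟨y, rfl⟩ := LieSubmodule.Quotient.surjective_mk' I y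
    exact LieHom.map_lie f x y

theorem quotientLift_mk {R L L' : Type*} [CommRing R] [LieRing L] [LieAlgebra R L] [LieRing L']
    [LieAlgebra R L'] (I : LieIdeal R L) (f : L →ₗ⁅R⁆ L') (h : ∀ x ∈ I, f x = 0) (x : L) :
    quotientLift I f h (LieSubmodule.Quotient.mk x) = f x := rfl

/-- Both maps are pulled back to the free Lie algebra, where a homomorphism is determined by its
values on generators; the quotient map is surjective. -/
theorem gim_hom_ext {ι L : Type*} {M : Matrix ι ι ℤ} [LieRing L] [LieAlgebra ℂ L]
    {φ ψ : gim M →ₗ⁅ℂ⁆ L} (h : ∀ g, φ (gimOf M g) = ψ (gimOf M g)) : φ = ψ := by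
  have key : ∀ χ : gim M →ₗ⁅ℂ⁆ L, ∃ F : FreeLieAlgebra ℂ (GimGen ι) →ₗ⁅ℂ⁆ L,
      ∀ x, F x = χ (LieSubmodule.Quotient.mk x) := fun χ =>
    ⟨{ toLinearMap := (χ : gim M →ₗ[ℂ] L).comp (Submodule.mkQ (gimIdeal M).toSubmodule)
       map_lie' := by
        intro x y
        exact LieHom.map_lie χ (LieSubmodule.Quotient.mk x) (LieSubmodule.Quotient.mk y) },
      fun x => rfl⟩
  obtain ⟨F, hF⟩ := key φ
  obtain ⟨F', hF'⟩ := key ψ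
  have hFF : F = F' := FreeLieAlgebra.hom_ext fun g => by rw [hF, hF']; exact h g
  ext x
  obtain ⟨x, rfl⟩ := LieSubmodule.Quotient.surjective_mk' _ x
  exact (hF x).symm.trans ((DFunLike.congr_fun hFF x).trans (hF' x))

/-! ### Positions in the matrix -/

variable {r : ℕ}

@[simp] theorem pos_inj {p q : Fin r} : pos r p = pos r q ↔ p = q := by
  simp [pos, Fin.ext_iff]

@[simp] theorem pos_ne_rev_pos (p q : Fin r) : pos r p ≠ (pos r q).rev := by
  simp only [pos, ne_eq, Fin.ext_iff, Fin.val_rev]; omega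

@[simp] theorem rev_pos_ne_pos (p q : Fin r) : (pos r q).rev ≠ pos r p :=
  (pos_ne_rev_pos p q).symm

@[simp] theorem rev_mid : (mid r).rev = mid r := by
  simp only [mid, Fin.ext_iff, Fin.val_rev]; omega

@[simp] theorem pos_ne_mid (p : Fin r) : pos r p ≠ mid r := by
  simp only [pos, mid, ne_eq, Fin.ext_iff]; omega

@[simp] theorem mid_ne_pos (p : Fin r) : mid r ≠ pos r p := (pos_ne_mid p).symm

@[simp] theorem rev_pos_ne_mid (p : Fin r) : (pos r p).rev ≠ mid r := by
  simp only [pos, mid, ne_eq, Fin.ext_iff, Fin.val_rev]; omega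

@[simp] theorem mid_ne_rev_pos (p : Fin r) : mid r ≠ (pos r p).rev := (rev_pos_ne_mid p).symm

@[simp] theorem wt_pos (p : Fin r) : wt r (pos r p) = eps p := by
  ext k
  simp [wt, eps, Pi.single_apply, eq_comm]

@[simp] theorem wt_rev (j : Fin (2 * r + 1)) : wt r j.rev = -wt r j := by
  ext k
  simp [wt]

@[simp] theorem wt_mid : wt r (mid r) = 0 := by
  ext k
  simp [wt]

/-- A functional on the antisymmetric diagonal matrices is determined on the first `r` places. -/
theorem sum_wt_mul (d : Fin (2 * r + 1) → ℂ) (hd : ∀ j, d j.rev = -d j) (j : Fin (2 * r + 1)) :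
    ∑ i, (wt r j i : ℂ) * d (pos r i) = d j := by
  have h1 : ∀ p : Fin r, ∑ i, (wt r (pos r p) i : ℂ) * d (pos r i) = d (pos r p) := by
    intro p
    simp [eps, Pi.single_apply]
  rcases lt_trichotomy (j : ℕ) r with h | h | h
  · exact h1 ⟨j, h⟩
  · obtain rfl : j = mid r := Fin.ext h
    -- Reversal fixes the middle place, so antisymmetry forces `d` to vanish there, in accordance
    -- with its weight 0.
    have := hd (mid r)
    rw [rev_mid] at this
    simp [self_eq_neg.1 this]
  · obtain ⟨p, rfl⟩ : ∃ p : Fin r, j = (pos r p).rev :=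
      ⟨⟨2 * r - j, by omega⟩, by simp only [pos, Fin.ext_iff, Fin.val_rev]; omega⟩
    simp only [wt_rev, Pi.neg_apply, Int.cast_neg, neg_mul, Finset.sum_neg_distrib, h1, hd]

/-! ### Elementary skew-hermitian matrices -/

theorem single_mul_single_ite {n A : Type*} [Fintype n] [DecidableEq n] [Ring A] (i j k l : n)
    (a b : A) : Matrix.single i j a * Matrix.single k l b =
      if j = k then Matrix.single i l (a * b) else 0 := by
  split_ifs with h
  · subst h; simp
  · exact Matrix.single_mul_single_of_ne _ _ _ _ h _

theorem single_mul_antiDiag {A : Type*} [Ring A] (i j : Fin (2 * r + 1))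
    (a : A) : Matrix.single i j a * antiDiag r A = Matrix.single i j.rev a := by
  ext k l
  rw [Matrix.mul_apply, Finset.sum_eq_single j]
  · by_cases h : i = k <;> simp [antiDiag, Matrix.single_apply, h, eq_comm]
  · intro m _ hm
    simp [hm.symm]
  · simp

theorem antiDiag_mul_single {A : Type*} [Ring A] (i j : Fin (2 * r + 1)) (a : A) :
    antiDiag r A * Matrix.single i j a = Matrix.single i.rev j a := by
  ext k l
  rw [Matrix.mul_apply, Finset.sum_eq_single i]
  · have e : i = k.rev ↔ i.rev = k := by rw [Fin.rev_eq_iff]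
    by_cases h : j = l <;> simp [antiDiag, Matrix.single_apply, h, e]
  · intro m _ hm
    simp [hm.symm]
  · simp

variable {A : Type*} [Ring A] [Algebra ℂ A] (η : Involution A)

@[simp] theorem Involution.apply_apply (a : A) : η (η a) = a := η.invol' a

theorem Involution.apply_mul (a b : A) : η (a * b) = η b * η a := η.map_mul' a b

@[simp] theorem Involution.apply_one : η (1 : A) = 1 := by
  -- Since `η` is involutive, evaluating `η (η 1 * 1)` in two ways gives `1 = η 1`.
  have h := η.map_mul' (η 1) 1
  have h1 : η (η 1 * 1) = η 1 * η (η 1) := h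
  simpa using h1.symm

@[simp] theorem Involution.apply_algebraMap (c : ℂ) : η (algebraMap ℂ A c) = algebraMap ℂ A c := by
  rw [Algebra.algebraMap_eq_smul_one, map_smul, Involution.apply_one]

theorem Involution.apply_mul_eq_one {a b : A} (h : a * b = 1) : η b * η a = 1 := by
  rw [← η.apply_mul, h, η.apply_one]

theorem conjT_add (M N : Matrix (Fin (2 * r + 1)) (Fin (2 * r + 1)) A) :
    conjT r η (M + N) = conjT r η M + conjT r η N := by
  ext i j
  simp [conjT]

theorem conjT_single (i j : Fin (2 * r + 1)) (a : A) :
    conjT r η (Matrix.single i j a) = Matrix.single j i (η a) := by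
  ext k l
  simp [conjT, Matrix.single_apply, and_comm]

theorem skewSingle_mem_bigA (i j : Fin (2 * r + 1)) (a : A) :
    Matrix.single i j a + Matrix.single j.rev i.rev (-η a) ∈ bigA r η := by
  change conjT r η _ * antiDiag r A + antiDiag r A * _ = 0
  simp only [conjT_add, conjT_single, add_mul, mul_add, single_mul_antiDiag, antiDiag_mul_single,
    Fin.rev_rev, map_neg, Involution.apply_apply]
  simp only [← Matrix.single_neg]
  abel

/-- A matrix unit at place `(i, j)` is an eigenvector for `d i - d j`. As reversal negates `d`, the
unit at `(j.rev, i.rev)` has the same eigenvalue. -/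
theorem skewSingle_mem_rootSpace (i j : Fin (2 * r + 1)) (a : A) :
    Matrix.single i j a + Matrix.single j.rev i.rev (-η a) ∈ rootSpace r η (wt r i - wt r j) := by
  refine ⟨skewSingle_mem_bigA η i j a, fun d hd => ?_⟩
  have hs : ∑ k, (((wt r i - wt r j) k : ℤ) : ℂ) * d (pos r k) = d i - d j := by
    simp only [Pi.sub_apply, Int.cast_sub, sub_mul, Finset.sum_sub_distrib, sum_wt_mul d hd]
  have key : ∀ (k l : Fin (2 * r + 1)) (b : A),
      ⁅Matrix.diagonal (fun j => algebraMap ℂ A (d j)), Matrix.single k l b⁆ =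
        (d k - d l) • Matrix.single k l b := by
    intro k l b
    ext m n
    rw [LieRing.of_associative_ring_bracket, Matrix.sub_apply, Matrix.diagonal_mul,
      Matrix.mul_diagonal, Matrix.smul_apply, Matrix.single_apply]
    split_ifs with h
    · rw [← h.1, ← h.2, ← Algebra.commutes, ← sub_mul, ← map_sub, Algebra.smul_def]
    · simp
  rw [hs, lie_add, key, key, smul_add, hd, hd]
  congr 2
  ring

theorem EUL_mem_rootSpace (p q : Fin r) (a : A) :
    EUL r η p q a ∈ rootSpace r η (eps p - eps q) := by
  simpa [EUL] using skewSingle_mem_rootSpace η (pos r p) (pos r q) a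

theorem EUR_mem_rootSpace (p q : Fin r) (a : A) :
    EUR r η p q a ∈ rootSpace r η (eps p + eps q) := by
  simpa [EUR] using skewSingle_mem_rootSpace η (pos r p) (pos r q).rev a

theorem EBL_mem_rootSpace (p q : Fin r) (a : A) :
    EBL r η p q a ∈ rootSpace r η (-eps p - eps q) := by
  simpa [EBL] using skewSingle_mem_rootSpace η (pos r p).rev (pos r q) a

theorem Evert_mem_rootSpace (k : Fin r) (a : A) : Evert r η k a ∈ rootSpace r η (eps k) := by
  simpa [Evert] using skewSingle_mem_rootSpace η (pos r k) (mid r) a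

theorem Ehort_mem_rootSpace (k : Fin r) (a : A) : Ehort r η k a ∈ rootSpace r η (-eps k) := by
  simpa [Ehort] using skewSingle_mem_rootSpace η (mid r) (pos r k) a

/-- The two summands trade places. This symmetry is the source of the sign convention for
indeterminates with reversed indices. -/
theorem EUR_swap (p q : Fin r) (a : A) : EUR r η q p (-η a) = EUR r η p q a := by
  simp [EUR, add_comm]

theorem EBL_swap (p q : Fin r) (a : A) : EBL r η q p (-η a) = EBL r η p q a := by
  simp [EBL, add_comm]

/-! ### Brackets of elementary skew-hermitian matrices -/

theorem lie_EUL_EUL {p q : Fin r} {a b : A} (hab : a * b = 1) (hba : b * a = 1) :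
    ⁅EUL r η p q a, EUL r η q p b⁆ = EUL r η p p 1 + EUL r η q q (-1) := by
  have h1 := η.apply_mul_eq_one hab
  have h2 := η.apply_mul_eq_one hba
  simp only [LieRing.of_associative_ring_bracket, EUL, mul_add, add_mul, single_mul_single_ite]
  simp [hab, hba, h1, h2, ← Matrix.single_neg]
  abel

theorem lie_EUR_EBL {p q : Fin r} (hpq : p ≠ q) {a b : A} (hab : a * b = 1) (hba : b * a = 1) :
    ⁅EUR r η p q a, EBL r η q p b⁆ = EUL r η p p 1 + EUL r η q q 1 := by
  have h1 := η.apply_mul_eq_one hab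
  have h2 := η.apply_mul_eq_one hba
  simp only [LieRing.of_associative_ring_bracket, EUL, EUR, EBL, mul_add, add_mul,
    single_mul_single_ite]
  simp [hpq, hpq.symm, hab, hba, h1, h2, ← Matrix.single_neg]
  abel

theorem lie_EBL_EUR {p q : Fin r} (hpq : p ≠ q) {a b : A} (hab : a * b = 1) (hba : b * a = 1) :
    ⁅EBL r η p q a, EUR r η q p b⁆ = EUL r η p p (-1) + EUL r η q q (-1) := by
  have h1 := η.apply_mul_eq_one hab
  have h2 := η.apply_mul_eq_one hba
  simp only [LieRing.of_associative_ring_bracket, EUL, EUR, EBL, mul_add, add_mul,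
    single_mul_single_ite]
  simp [hpq, hpq.symm, hab, hba, h1, h2, ← Matrix.single_neg]
  abel

theorem lie_Evert_Ehort (k : Fin r) {a : A} (ha : a * a = 2) (hη : η a = a) :
    ⁅Evert r η k a, Ehort r η k a⁆ = EUL r η k k 2 := by
  have h2 : η (2 : A) = 2 := by rw [← ha, η.apply_mul, hη]
  simp only [LieRing.of_associative_ring_bracket, EUL, Evert, Ehort, mul_add, add_mul,
    single_mul_single_ite]
  simp [ha, hη, h2, ← Matrix.single_neg]
  abel

/-! ### Brackets of long roots with the same support -/

theorem lie_EUL_EUR_eq_zero {p q : Fin r} (hpq : p ≠ q) {a u : A} (h : a * η u = u * η a) :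
    ⁅EUL r η p q a, EUR r η p q u⁆ = 0 := by
  simp only [LieRing.of_associative_ring_bracket, EUL, EUR, mul_add, add_mul,
    single_mul_single_ite]
  simp [hpq, hpq.symm, h]

/-- The bracket has weight `-2ε_q`, a root of `BC_r`, so weights do not suffice. Its only entry is
`η v * a - η a * v`, at place `((pos r q).rev, pos r q)`. -/
theorem lie_EUL_EBL_eq_zero {p q : Fin r} (hpq : p ≠ q) {a v : A} (h : η a * v = η v * a) :
    ⁅EUL r η p q a, EBL r η p q v⁆ = 0 := by
  simp only [LieRing.of_associative_ring_bracket, EUL, EBL, mul_add, add_mul,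
    single_mul_single_ite]
  simp [hpq, hpq.symm, h]

/-- `X` and `X'` commute with `Y` and `Y'`. -/
def CommutingPairs {L : Type*} [LieRing L] (X X' Y Y' : L) : Prop :=
  ⁅X, Y⁆ = 0 ∧ ⁅X, Y'⁆ = 0 ∧ ⁅X', Y⁆ = 0 ∧ ⁅X', Y'⁆ = 0

theorem CommutingPairs.symm {L : Type*} [LieRing L] {X X' Y Y' : L}
    (h : CommutingPairs X X' Y Y') : CommutingPairs Y Y' X X' := by
  obtain ⟨h1, h2, h3, h4⟩ := h
  refine ⟨?_, ?_, ?_, ?_⟩ <;> rw [← lie_skew] <;> simp [*]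

/-- Each identity arises from `a * v = u * b` by moving units across. With `b = η a` and `v = η u`
these are the conditions for the other three brackets of a commuting pair. -/
theorem units_intertwine {R : Type*} [Ring R] {a b u v a' b' u' v' : R} (ha : a * a' = 1)
    (ha' : a' * a = 1) (hb : b * b' = 1) (hb' : b' * b = 1) (hu' : u' * u = 1) (hv : v * v' = 1)
    (h : a * v = u * b) :
    v * b' = a' * u ∧ b * v' = u' * a ∧ b' * u' = v' * a' := by
  refine ⟨?_, ?_, ?_⟩
  · calc v * b' = (a' * a) * v * b' := by rw [ha', one_mul]
      _ = a' * (a * v) * b' := by noncomm_ring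
      _ = a' * u * (b * b') := by rw [h]; noncomm_ring
      _ = a' * u := by rw [hb, mul_one]
  · calc b * v' = (u' * u) * b * v' := by rw [hu', one_mul]
      _ = u' * (u * b) * v' := by noncomm_ring
      _ = u' * a * (v * v') := by rw [← h]; noncomm_ring
      _ = u' * a := by rw [hv, mul_one]
  · calc b' * u' = b' * u' * (a * (v * v') * a') := by rw [hv, mul_one, ha, mul_one]
      _ = b' * u' * (a * v) * v' * a' := by noncomm_ring
      _ = b' * ((u' * u) * b) * v' * a' := by rw [h]; noncomm_ring
      _ = v' * a' := by rw [hu', one_mul, hb', one_mul]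

theorem commutingPairs_EUR {p q : Fin r} (hpq : p ≠ q) {a a' u u' : A} (ha : a * a' = 1)
    (ha' : a' * a = 1) (hu' : u' * u = 1) (h : a * η u = u * η a) :
    CommutingPairs (EUL r η p q a) (EUL r η q p a') (EUR r η p q u) (EBL r η q p u') := by
  obtain ⟨e1, e2, e3⟩ := units_intertwine ha ha' (η.apply_mul_eq_one ha')
    (η.apply_mul_eq_one ha) hu' (η.apply_mul_eq_one hu') h
  refine ⟨lie_EUL_EUR_eq_zero η hpq h, ?_, ?_, ?_⟩
  · rw [← EBL_swap]
    exact lie_EUL_EBL_eq_zero η hpq (by simp [e2])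
  · rw [← EUR_swap]
    exact lie_EUL_EUR_eq_zero η hpq.symm (by simp [e1])
  · exact lie_EUL_EBL_eq_zero η hpq.symm e3

theorem commutingPairs_EBL {p q : Fin r} (hpq : p ≠ q) {a a' u u' : A} (ha : a * a' = 1)
    (ha' : a' * a = 1) (hu : u * u' = 1) (h : η a * u = η u * a) :
    CommutingPairs (EUL r η p q a) (EUL r η q p a') (EBL r η p q u) (EUR r η q p u') := by
  obtain ⟨e1, e2, e3⟩ := units_intertwine (η.apply_mul_eq_one ha') (η.apply_mul_eq_one ha) ha ha'
    (η.apply_mul_eq_one hu) hu h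
  refine ⟨lie_EUL_EBL_eq_zero η hpq h, ?_, ?_, ?_⟩
  · rw [← EUR_swap]
    exact lie_EUL_EUR_eq_zero η hpq (by simp [e2])
  · rw [← EBL_swap]
    exact lie_EUL_EBL_eq_zero η hpq.symm (by simp [e1])
  · exact lie_EUL_EUR_eq_zero η hpq.symm e3

/-- Reversing the indices of `EUR` and `EBL` replaces `u` by `-η u`, which reduces this to
`commutingPairs_EUR`; the signs cancel in the hypothesis on `a` and `u`. -/
theorem commutingPairs_EUR_swap {p q : Fin r} (hpq : p ≠ q) {a a' u u' : A} (ha : a * a' = 1)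
    (ha' : a' * a = 1) (hu : u * u' = 1) (h : a * u = η u * η a) :
    CommutingPairs (EUL r η q p a) (EUL r η p q a') (EUR r η p q u) (EBL r η q p u') := by
  rw [← EUR_swap, ← EBL_swap]
  refine commutingPairs_EUR η hpq.symm ha ha' ?_ ?_
  · simpa using η.apply_mul_eq_one hu
  · simpa using h

theorem commutingPairs_EBL_swap {p q : Fin r} (hpq : p ≠ q) {a a' u u' : A} (ha : a * a' = 1)
    (ha' : a' * a = 1) (hu' : u' * u = 1) (h : η a * η u = u * a) :
    CommutingPairs (EUL r η q p a) (EUL r η p q a') (EBL r η p q u) (EUR r η q p u') := by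
  rw [← EBL_swap, ← EUR_swap]
  refine commutingPairs_EBL η hpq.symm ha ha' ?_ ?_
  · simpa using η.apply_mul_eq_one hu'
  · simpa using h

theorem algebraMap_sqrt_two_mul_self (A : Type*) [Ring A] [Algebra ℂ A] :
    algebraMap ℂ A (Real.sqrt 2 : ℝ) * algebraMap ℂ A (Real.sqrt 2 : ℝ) = 2 := by
  rw [← map_mul, ← Complex.ofReal_mul, Real.mul_self_sqrt (by norm_num), Complex.ofReal_ofNat]
  exact map_ofNat (algebraMap ℂ A) 2

end

end GimB

namespace GimB

noncomputable section

variable {r : ℕ}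

/-! ### Lengths of roots -/

theorem dotProduct_self_of_mem_rootsBC {v : Fin r → ℤ} (hv : v ∈ rootsBC r) :
    v ⬝ᵥ v = 1 ∨ v ⬝ᵥ v = 2 ∨ (v ⬝ᵥ v = 4 ∧ ∀ k, Even (v k)) := by
  rcases hv with ⟨i, j, hij, rfl | rfl | rfl⟩ | ⟨i, rfl | rfl | rfl | rfl⟩
  · right; left; simp [eps_dot, hij, hij.symm]
  · right; left; simp [eps_dot, hij, hij.symm]
  · right; left; simp [eps_dot, hij, hij.symm]
  · left; simp [eps_dot]
  · left; simp [eps_dot]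
  · right; right; exact ⟨by simp [eps_dot, -nsmul_eq_mul], fun k => by simp⟩
  · right; right; exact ⟨by simp [eps_dot, -nsmul_eq_mul], fun k => by simp⟩

/-- A condition under which the root space of `v` vanishes. -/
def NonRoot (v : Fin r → ℤ) : Prop :=
  5 ≤ v ⬝ᵥ v ∨ v ⬝ᵥ v = 3 ∨ (v ⬝ᵥ v = 4 ∧ ∃ k, ¬Even (v k))

theorem NonRoot.neg {v : Fin r → ℤ} (h : NonRoot v) : NonRoot (-v) := by
  simpa [NonRoot] using h

variable {A : Type*} [Ring A] [Algebra ℂ A] {η : Involution A}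

/-- The zero vector has length 0, and no root of `BC_r` has the lengths and parities allowed by
`NonRoot`. -/
theorem NonRoot.eq_zero {v : Fin r → ℤ} (h : NonRoot v)
    {T : Matrix (Fin (2 * r + 1)) (Fin (2 * r + 1)) A} (hT : T ∈ rootSpace r η v) : T = 0 := by
  refine rootSpace_eq_zero ?_ ?_ hT
  · rintro rfl
    simp [NonRoot] at h
  · intro hv
    have := dotProduct_self_of_mem_rootsBC hv
    rcases h with h | h | ⟨h, k, hk⟩
    · omega
    · omega
    · rcases this with h' | h' | ⟨-, h'⟩
      · omega
      · omega
      · exact hk (h' k)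

/-! ### Vanishing of brackets by weight -/

theorem ad_pow_mem_rootSpace {α β : Fin r → ℤ}
    {X Y : Matrix (Fin (2 * r + 1)) (Fin (2 * r + 1)) A}
    (hX : X ∈ rootSpace r η α) (hY : Y ∈ rootSpace r η β) (n : ℕ) :
    (LieAlgebra.ad ℂ (Matrix (Fin (2 * r + 1)) (Fin (2 * r + 1)) A) X ^ n) Y ∈
      rootSpace r η (n • α + β) := by
  induction n with
  | zero => simpa using hY
  | succ n ih =>
    rw [pow_succ', Module.End.mul_apply, LieAlgebra.ad_apply]
    convert lie_mem_rootSpace hX ih using 2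
    rw [succ_nsmul]
    abel

theorem commutingPairs_of_nonRoot {α β : Fin r → ℤ}
    {X X' Y Y' : Matrix (Fin (2 * r + 1)) (Fin (2 * r + 1)) A}
    (hX : X ∈ rootSpace r η α) (hX' : X' ∈ rootSpace r η (-α)) (hY : Y ∈ rootSpace r η β)
    (hY' : Y' ∈ rootSpace r η (-β)) (hadd : NonRoot (α + β)) (hsub : NonRoot (α - β)) :
    CommutingPairs X X' Y Y' := by
  refine ⟨hadd.eq_zero (lie_mem_rootSpace hX hY), ?_, ?_, ?_⟩
  · have := lie_mem_rootSpace hX hY'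
    rw [← sub_eq_add_neg] at this
    exact hsub.eq_zero this
  · have := lie_mem_rootSpace hX' hY
    rw [neg_add_eq_sub, ← neg_sub] at this
    exact hsub.neg.eq_zero this
  · have := lie_mem_rootSpace hX' hY'
    rw [← neg_add] at this
    exact hadd.neg.eq_zero this

theorem add_dot_self (α β : Fin r → ℤ) :
    (α + β) ⬝ᵥ (α + β) = α ⬝ᵥ α + 2 * (α ⬝ᵥ β) + β ⬝ᵥ β := by
  simp only [add_dotProduct, dotProduct_add, dotProduct_comm β α]
  ring

theorem sub_dot_self (α β : Fin r → ℤ) :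
    (α - β) ⬝ᵥ (α - β) = α ⬝ᵥ α - 2 * (α ⬝ᵥ β) + β ⬝ᵥ β := by
  simp only [sub_dotProduct, dotProduct_sub, dotProduct_comm β α]
  ring

theorem nsmul_add_dot_self (n : ℕ) (α β : Fin r → ℤ) :
    (n • α + β) ⬝ᵥ (n • α + β) = n ^ 2 * (α ⬝ᵥ α) + 2 * n * (α ⬝ᵥ β) + β ⬝ᵥ β := by
  rw [add_dot_self]
  simp only [smul_dotProduct, dotProduct_smul]
  simp only [nsmul_eq_mul]
  ring

/-- Modulo 2 the signs of a long root disappear, so this recovers the support `{p, q}` of one root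
from that of the other. The parities at `p` and `q` alone decide. -/
theorem same_support {p q s t : Fin r} (hpq : p ≠ q) (hst : s ≠ t)
    (h : ∀ k, Even (eps p k + eps q k + eps s k + eps t k)) :
    (s = p ∧ t = q) ∨ (s = q ∧ t = p) := by
  have hp := h p
  have hq := h q
  simp only [eps, Pi.single_apply] at hp hq
  by_cases h1 : s = p <;> by_cases h2 : t = q <;> by_cases h3 : s = q <;> by_cases h4 : t = p <;>
    simp_all [eq_comm]

/-! ### Coroots -/

/-- The diagonal matrix in `so_{2r+1}(ℂ)` whose first `r` entries are `c`. -/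
def corootDiag (A : Type*) [Ring A] [Algebra ℂ A] (c : Fin r → ℤ) :
    Matrix (Fin (2 * r + 1)) (Fin (2 * r + 1)) A :=
  Matrix.diagonal fun j => algebraMap ℂ A ((c ⬝ᵥ wt r j : ℤ) : ℂ)

theorem corootDiag_add (c c' : Fin r → ℤ) :
    corootDiag A (c + c') = corootDiag A c + corootDiag A c' := by
  simp [corootDiag, add_dotProduct]

/-- An integer is fixed by `η`, so the two diagonal entries are `m` and `-m`, which are the values
of `m • eps p` on the weights of those places. -/
theorem EUL_self_intCast (p : Fin r) (m : ℤ) :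
    EUL r η p p (m : A) = corootDiag A (m • eps p) := by
  have hm : η ((m : ℤ) : A) = m := by
    simpa using η.apply_algebraMap (m : ℂ)
  ext i j
  simp only [EUL, corootDiag, hm, Matrix.add_apply, Matrix.single_apply, Matrix.diagonal_apply]
  by_cases hij : i = j
  · subst hij
    by_cases h1 : i = pos r p
    · subst h1; simp [eps_dot, -zsmul_eq_mul]
    · by_cases h2 : i = (pos r p).rev
      · subst h2; simp [eps_dot, -zsmul_eq_mul]
      · have h3 : i.rev ≠ pos r p := fun h => h2 (by rw [← h, Fin.rev_rev])
        have : eps p ⬝ᵥ wt r i = 0 := by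
          simp [eps, wt, h1, h3]
        simp [Ne.symm h1, Ne.symm h2, this, -zsmul_eq_mul]
  · have h1 : ¬(pos r p = i ∧ pos r p = j) := fun h => hij (h.1.symm.trans h.2)
    have h2 : ¬((pos r p).rev = i ∧ (pos r p).rev = j) := fun h => hij (h.1.symm.trans h.2)
    simp [h1, h2, hij]

theorem lie_corootDiag (c : Fin r → ℤ) {μ : Fin r → ℤ}
    {T : Matrix (Fin (2 * r + 1)) (Fin (2 * r + 1)) A} (hT : T ∈ rootSpace r η μ) :
    ⁅corootDiag A c, T⁆ = (c ⬝ᵥ μ) • T := by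
  -- The diagonal `c ⬝ᵥ wt r j` is antisymmetric by `wt_rev`, so the eigenvalue condition defining
  -- the root space applies to it.
  rw [corootDiag, hT.2 _ (fun j => by simp), ← Int.cast_smul_eq_zsmul ℂ]
  congr 1
  have h : ∀ k, c ⬝ᵥ wt r (pos r k) = c k := fun k => by simp [eps]
  simp only [h, mul_comm]
  simp [dotProduct]

end

end GimB

namespace GimB

noncomputable section

variable {r : ℕ} {N : LongRoot r → ℕ}

open LongRoot CoordGen

/-! ### Relations in the coordinate algebra -/

theorem coord_mul_coordInv (μ : LongRoot r) (i : Fin (N μ)) : coord N μ i * coordInv N μ i = 1 := by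
  by_cases h : μ.IsOmega
  · simpa [coord, coordInv, h, gen] using gen_rel N (.x_mul_inv μ h i)
  · simpa [coord, coordInv, h, gen] using gen_rel N (.y_mul_inv μ h i)

theorem coordInv_mul_coord (μ : LongRoot r) (i : Fin (N μ)) : coordInv N μ i * coord N μ i = 1 := by
  by_cases h : μ.IsOmega
  · simpa [coord, coordInv, h, gen] using gen_rel N (.x_inv_mul μ h i)
  · simpa [coord, coordInv, h, gen] using gen_rel N (.y_inv_mul μ h i)

theorem eta_coord_of_isOmega {μ : LongRoot r} (h : μ.IsOmega) (i : Fin (N μ)) :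
    eta N (coord N μ i) = coord N μ i := by
  simp [coord, h, eta_gen, swapGen]

theorem coord_sub {p q : Fin r} (hpq : p ≠ q) (i : Fin (N (sub p q hpq))) :
    coord N (sub p q hpq) i = gen N (y (sub p q hpq) id i) :=
  dif_neg id

/-- Expressed through `η`, which fixes `x` and exchanges `y` and `z`, the relations of `𝔟` for `Ω`
and for `Θ` become the same identity. -/
theorem coord_sub_mul_add {p q : Fin r} (hpq : p < q) (i : Fin (N (sub p q hpq.ne)))
    (j : Fin (N (add p q hpq))) :
    coord N (sub p q hpq.ne) i * eta N (coord N (add p q hpq) j) =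
      coord N (add p q hpq) j * eta N (coord N (sub p q hpq.ne) i) := by
  rw [coord_sub]
  by_cases h : (add p q hpq).IsOmega
  · simp only [coord, dif_pos h, eta_gen, swapGen]
    simpa [gen] using gen_rel N (.add_omega p q hpq h i j)
  · simp only [coord, dif_neg h, eta_gen, swapGen]
    simpa [gen] using gen_rel N (.add_theta p q hpq h i j)

/-- This is the relation for `ε_q - ε_p` with the indices of the sum reversed; the two minus signs
of the convention cancel. -/
theorem coord_sub_mul_add' {p q : Fin r} (hpq : p < q) (i : Fin (N (sub q p hpq.ne')))
    (j : Fin (N (add p q hpq))) :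
    coord N (sub q p hpq.ne') i * coord N (add p q hpq) j =
      eta N (coord N (add p q hpq) j) * eta N (coord N (sub q p hpq.ne') i) := by
  rw [coord_sub]
  by_cases h : (add p q hpq).IsOmega
  · simp only [coord, dif_pos h, eta_gen, swapGen]
    simpa [gen] using gen_rel N (.add_omega' p q hpq h i j)
  · simp only [coord, dif_neg h, eta_gen, swapGen]
    simpa [gen] using gen_rel N (.add_theta' p q hpq h i j)

theorem coord_sub_mul_neg {p q : Fin r} (hpq : p < q) (i : Fin (N (sub p q hpq.ne)))
    (j : Fin (N (neg p q hpq))) :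
    eta N (coord N (sub p q hpq.ne) i) * coord N (neg p q hpq) j =
      eta N (coord N (neg p q hpq) j) * coord N (sub p q hpq.ne) i := by
  rw [coord_sub]
  by_cases h : (neg p q hpq).IsOmega
  · simp only [coord, dif_pos h, eta_gen, swapGen]
    simpa [gen] using gen_rel N (.neg_omega p q hpq h i j)
  · simp only [coord, dif_neg h, eta_gen, swapGen]
    simpa [gen] using gen_rel N (.neg_theta p q hpq h i j)

theorem coord_sub_mul_neg' {p q : Fin r} (hpq : p < q) (i : Fin (N (sub q p hpq.ne')))
    (j : Fin (N (neg p q hpq))) :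
    eta N (coord N (sub q p hpq.ne') i) * eta N (coord N (neg p q hpq) j) =
      coord N (neg p q hpq) j * coord N (sub q p hpq.ne') i := by
  rw [coord_sub]
  by_cases h : (neg p q hpq).IsOmega
  · simp only [coord, dif_pos h, eta_gen, swapGen]
    simpa [gen] using gen_rel N (.neg_omega' p q hpq h i j)
  · simp only [coord, dif_neg h, eta_gen, swapGen]
    simpa [gen] using gen_rel N (.neg_theta' p q hpq h i j)

/-! ### The images of the generators -/

theorem eImg_mem_rootSpace (i : Idx r N) : eImg N i ∈ rootSpace r (eta N) (rootOf r N i) := by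
  rcases i with i | ⟨⟨p, q, h⟩ | ⟨p, q, h⟩ | ⟨p, q, h⟩, k⟩
  · simp only [eImg, rootOf, simpleRoot]
    split_ifs
    · exact EUL_mem_rootSpace _ _ _ _
    · exact Evert_mem_rootSpace _ _ _
  · exact EUL_mem_rootSpace _ _ _ _
  · exact EUR_mem_rootSpace _ _ _ _
  · exact EBL_mem_rootSpace _ _ _ _

theorem fImg_mem_rootSpace (i : Idx r N) : fImg N i ∈ rootSpace r (eta N) (-rootOf r N i) := by
  rcases i with i | ⟨⟨p, q, h⟩ | ⟨p, q, h⟩ | ⟨p, q, h⟩, k⟩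
  · simp only [fImg, rootOf, simpleRoot]
    split_ifs
    · rw [neg_sub]; exact EUL_mem_rootSpace _ _ _ _
    · exact Ehort_mem_rootSpace _ _ _
  · simp only [rootOf, vec, neg_sub]; exact EUL_mem_rootSpace _ _ _ _
  · simp only [rootOf, vec, neg_add_rev]; exact EBL_mem_rootSpace _ _ _ _
  · simp only [rootOf, vec, neg_sub, sub_neg_eq_add]; exact EUR_mem_rootSpace _ _ _ _

theorem rootOf_mem_rootsBC (i : Idx r N) : rootOf r N i ∈ rootsBC r := by
  rcases i with i | ⟨⟨p, q, h⟩ | ⟨p, q, h⟩ | ⟨p, q, h⟩, k⟩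
  · simp only [rootOf, simpleRoot]
    split_ifs
    · exact Or.inl ⟨_, _, by simp [Fin.ext_iff], Or.inl rfl⟩
    · exact Or.inr ⟨_, Or.inl rfl⟩
  · exact Or.inl ⟨p, q, h, Or.inl rfl⟩
  · exact Or.inl ⟨p, q, h.ne, Or.inr (Or.inl rfl)⟩
  · exact Or.inl ⟨p, q, h.ne, Or.inr (Or.inr rfl)⟩

theorem neg_mem_rootsBC {v : Fin r → ℤ} (hv : v ∈ rootsBC r) : -v ∈ rootsBC r := by
  rcases hv with ⟨i, j, hij, rfl | rfl | rfl⟩ | ⟨i, rfl | rfl | rfl | rfl⟩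
  · exact Or.inl ⟨j, i, hij.symm, Or.inl (by abel)⟩
  · exact Or.inl ⟨i, j, hij, Or.inr (Or.inr (by abel))⟩
  · exact Or.inl ⟨i, j, hij, Or.inr (Or.inl (by abel))⟩
  · exact Or.inr ⟨i, Or.inr (Or.inl rfl)⟩
  · exact Or.inr ⟨i, Or.inl (neg_neg _)⟩
  · exact Or.inr ⟨i, Or.inr (Or.inr (Or.inr rfl))⟩
  · exact Or.inr ⟨i, Or.inr (Or.inr (Or.inl (neg_neg _)))⟩

theorem sqrtTwo_mul_self : sqrtTwo N * sqrtTwo N = 2 :=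
  algebraMap_sqrt_two_mul_self _

theorem lie_eImg_fImg (i : Idx r N) : ⁅eImg N i, fImg N i⁆ = hImg N i := by
  rcases i with i | ⟨⟨p, q, h⟩ | ⟨p, q, h⟩ | ⟨p, q, h⟩, k⟩
  · simp only [eImg, fImg, hImg]
    split_ifs
    · exact lie_EUL_EUL _ (mul_one _) (mul_one _)
    · exact lie_Evert_Ehort _ _ sqrtTwo_mul_self ((eta N).apply_algebraMap _)
  · exact lie_EUL_EUL _ (coord_mul_coordInv _ _) (coordInv_mul_coord _ _)
  · exact lie_EUR_EBL _ h.ne (coord_mul_coordInv _ _) (coordInv_mul_coord _ _)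
  · exact lie_EBL_EUR _ h.ne (coord_mul_coordInv _ _) (coordInv_mul_coord _ _)

/-- In weight zero, membership has to come from brackets of opposite root spaces, and `[e_i, f_i]`
is such a bracket. -/
theorem hImg_mem_so (i : Idx r N) : hImg N i ∈ so r (eta N) := by
  rw [← lie_eImg_fImg]
  exact rootBracket_le_so (rootOf_mem_rootsBC i)
    (Submodule.subset_span ⟨_, eImg_mem_rootSpace i, _, fImg_mem_rootSpace i, rfl⟩)

/-- The coroot of the root with index `i`. -/
def coroot (i : Idx r N) : Fin r → ℤ :=
  (2 / (rootOf r N i ⬝ᵥ rootOf r N i)) • rootOf r N i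

/-- Squared lengths are 1 or 2, so the integer divisions on both sides are exact. -/
theorem coroot_dot (i j : Idx r N) : coroot i ⬝ᵥ rootOf r N j = affMatrix r N i j := by
  rw [coroot, smul_dotProduct, affMatrix, Matrix.of_apply, smul_eq_mul]
  rcases rootOf_dot_self r N i with h | h <;> simp [h]

theorem hImg_eq_corootDiag (i : Idx r N) : hImg N i = corootDiag (CoordAlg N) (coroot i) := by
  have h1 : ∀ p, EUL r (eta N) p p 1 = corootDiag _ (eps p) := fun p => by
    simpa using EUL_self_intCast (η := eta N) p 1
  have h2 : ∀ p, EUL r (eta N) p p (-1) = corootDiag _ (-eps p) := fun p => by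
    simpa using EUL_self_intCast (η := eta N) p (-1)
  rcases i with i | ⟨⟨p, q, h⟩ | ⟨p, q, h⟩ | ⟨p, q, h⟩, k⟩
  · by_cases h : (i : ℕ) + 1 < r
    · have : (i : ℕ) ≠ i + 1 := by omega
      simp [hImg, coroot, rootOf, simpleRoot, h, h1, h2, ← corootDiag_add, eps_dot, Fin.ext_iff,
        ← sub_eq_add_neg]
    · have h3 : EUL r (eta N) i i 2 = corootDiag _ ((2 : ℤ) • eps i) := by
        simpa using EUL_self_intCast (η := eta N) i 2
      simp [hImg, coroot, rootOf, simpleRoot, h, h3, eps_dot]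
  · simp [hImg, coroot, rootOf, vec, h, h.symm, h1, h2, ← corootDiag_add, eps_dot,
      ← sub_eq_add_neg]
  · simp [hImg, coroot, rootOf, vec, h.ne, h.ne', h1, ← corootDiag_add, eps_dot]
  · simp [hImg, coroot, rootOf, vec, h.ne, h.ne', h2, ← corootDiag_add, eps_dot,
      ← sub_eq_add_neg]

theorem lie_hImg (i j : Idx r N) :
    ⁅hImg N i, eImg N j⁆ = affMatrix r N i j • eImg N j ∧
      ⁅hImg N i, fImg N j⁆ = -(affMatrix r N i j • fImg N j) := by
  rw [hImg_eq_corootDiag, lie_corootDiag _ (eImg_mem_rootSpace j),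
    lie_corootDiag _ (fImg_mem_rootSpace j), dotProduct_neg, coroot_dot, neg_smul]
  exact ⟨rfl, rfl⟩

/-- Only the last simple root is short, since all adjoined roots are long. This removes every case
of two distinct short roots below. -/
theorem eq_of_short {i j : Idx r N} (hi : rootOf r N i ⬝ᵥ rootOf r N i = 1)
    (hj : rootOf r N j ⬝ᵥ rootOf r N j = 1) : i = j := by
  have key : ∀ k : Idx r N, rootOf r N k ⬝ᵥ rootOf r N k = 1 →
      ∃ l : Fin r, k = Sum.inl l ∧ (l : ℕ) + 1 = r := by
    rintro (l | ⟨⟨p, q, h⟩ | ⟨p, q, h⟩ | ⟨p, q, h⟩, k⟩) hk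
    · refine ⟨l, rfl, ?_⟩
      by_contra hne
      have hl : (l : ℕ) + 1 < r := by omega
      simp [rootOf, simpleRoot, hl, eps_dot, Fin.ext_iff] at hk
    · simp [rootOf, vec, eps_dot, h, h.symm] at hk
    · simp [rootOf, vec, eps_dot, h.ne, h.ne'] at hk
    · simp [rootOf, vec, eps_dot, h.ne, h.ne'] at hk
  obtain ⟨l, rfl, hl⟩ := key i hi
  obtain ⟨l', rfl, hl'⟩ := key j hj
  congr 1
  exact Fin.ext (by omega)

/-! ### Orthogonal roots -/

/-- The three shapes of the images of `e_i` and `f_i`, where the root `v` of index `i` is long. -/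
inductive LongShape (N : LongRoot r → ℕ) : (v : Fin r → ℤ) →
    (X X' : Matrix (Fin (2 * r + 1)) (Fin (2 * r + 1)) (CoordAlg N)) → Prop
  | simple (p q : Fin r) (h : (q : ℕ) = p + 1) :
      LongShape N (eps p - eps q) (EUL r (eta N) p q 1) (EUL r (eta N) q p 1)
  | sub (p q : Fin r) (h : p ≠ q) (i : Fin (N (sub p q h))) :
      LongShape N (eps p - eps q) (EUL r (eta N) p q (coord N _ i))
        (EUL r (eta N) q p (coordInv N _ i))
  | add (p q : Fin r) (h : p < q) (i : Fin (N (add p q h))) :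
      LongShape N (eps p + eps q) (EUR r (eta N) p q (coord N _ i))
        (EBL r (eta N) q p (coordInv N _ i))
  | neg (p q : Fin r) (h : p < q) (i : Fin (N (neg p q h))) :
      LongShape N (-eps p - eps q) (EBL r (eta N) p q (coord N _ i))
        (EUR r (eta N) q p (coordInv N _ i))

theorem longShape (i : Idx r N) (hi : rootOf r N i ⬝ᵥ rootOf r N i = 2) :
    LongShape N (rootOf r N i) (eImg N i) (fImg N i) := by
  rcases i with i | ⟨⟨p, q, h⟩ | ⟨p, q, h⟩ | ⟨p, q, h⟩, k⟩
  · by_cases h : (i : ℕ) + 1 < r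
    · simp only [rootOf, simpleRoot, eImg, fImg, h, dif_pos]
      exact .simple _ _ rfl
    · simp [rootOf, simpleRoot, h, eps_dot] at hi
  · exact .sub p q h k
  · exact .add p q h k
  · exact .neg p q h k

theorem commutingPairs_add {p q s t : Fin r} (h : p < q) (j : Fin (N (add p q h)))
    (hst : (s = p ∧ t = q) ∨ (s = q ∧ t = p)) {a a' : CoordAlg N} (ha : a * a' = 1)
    (ha' : a' * a = 1) (hsh : (a = 1 ∧ (t : ℕ) = s + 1) ∨ ∃ hne i, a = coord N (sub s t hne) i) :
    CommutingPairs (EUL r (eta N) s t a) (EUL r (eta N) t s a')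
      (EUR r (eta N) p q (coord N _ j)) (EBL r (eta N) q p (coordInv N _ j)) := by
  rcases hst with ⟨rfl, rfl⟩ | ⟨rfl, rfl⟩
  · refine commutingPairs_EUR _ h.ne ha ha' (coordInv_mul_coord _ _) ?_
    rcases hsh with ⟨rfl, e⟩ | ⟨hne, i, rfl⟩
    -- Here `a = 1` comes from a simple root, so `t = s + 1`, the adjoined root lies in `Ω`, and `η`
    -- fixes its indeterminate.
    · simp [eta_coord_of_isOmega (μ := add s t h) e]
    · exact coord_sub_mul_add h i j
  · refine commutingPairs_EUR_swap _ h.ne ha ha' (coord_mul_coordInv _ _) ?_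
    rcases hsh with ⟨rfl, e⟩ | ⟨hne, i, rfl⟩
    -- A simple root `ε_s - ε_t` has `s < t`, so it never occurs with reversed indices.
    · exact absurd (Fin.lt_def.1 h) (by omega)
    · exact coord_sub_mul_add' h i j

theorem commutingPairs_neg {p q s t : Fin r} (h : p < q) (j : Fin (N (neg p q h)))
    (hst : (s = p ∧ t = q) ∨ (s = q ∧ t = p)) {a a' : CoordAlg N} (ha : a * a' = 1)
    (ha' : a' * a = 1) (hsh : (a = 1 ∧ (t : ℕ) = s + 1) ∨ ∃ hne i, a = coord N (sub s t hne) i) :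
    CommutingPairs (EUL r (eta N) s t a) (EUL r (eta N) t s a')
      (EBL r (eta N) p q (coord N _ j)) (EUR r (eta N) q p (coordInv N _ j)) := by
  rcases hst with ⟨rfl, rfl⟩ | ⟨rfl, rfl⟩
  · refine commutingPairs_EBL _ h.ne ha ha' (coord_mul_coordInv _ _) ?_
    rcases hsh with ⟨rfl, e⟩ | ⟨hne, i, rfl⟩
    · simp [eta_coord_of_isOmega (μ := neg s t h) e]
    · exact coord_sub_mul_neg h i j
  · refine commutingPairs_EBL_swap _ h.ne ha ha' (coordInv_mul_coord _ _) ?_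
    rcases hsh with ⟨rfl, e⟩ | ⟨hne, i, rfl⟩
    · exact absurd (Fin.lt_def.1 h) (by omega)
    · exact coord_sub_mul_neg' h i j

/-- Long roots split into differences and signed sums. For a sum, the commutation with every
difference of the same support is packaged in the conclusion, so that only these two types need be
compared. -/
theorem LongShape.exists_support {v : Fin r → ℤ}
    {X X' : Matrix (Fin (2 * r + 1)) (Fin (2 * r + 1)) (CoordAlg N)} (h : LongShape N v X X') :
    (∃ p q a a', p ≠ q ∧ v = eps p - eps q ∧ X = EUL r (eta N) p q a ∧ X' = EUL r (eta N) q p a' ∧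
      a * a' = 1 ∧ a' * a = 1 ∧
      ((a = 1 ∧ (q : ℕ) = p + 1) ∨ ∃ hne i, a = coord N (.sub p q hne) i)) ∨
    (∃ p q, p < q ∧ (v = eps p + eps q ∨ v = -eps p - eps q) ∧
      ∀ s t a a', ((s = p ∧ t = q) ∨ (s = q ∧ t = p)) → a * a' = 1 → a' * a = 1 →
      ((a = 1 ∧ (t : ℕ) = s + 1) ∨ ∃ hne i, a = coord N (.sub s t hne) i) →
      CommutingPairs (EUL r (eta N) s t a) (EUL r (eta N) t s a') X X') := by
  cases h with
  | simple p q h =>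
    exact Or.inl ⟨p, q, 1, 1, by simp [Fin.ext_iff, h], rfl, rfl, rfl, mul_one _, mul_one _,
      Or.inl ⟨rfl, h⟩⟩
  | sub p q h i =>
    exact Or.inl ⟨p, q, _, _, h, rfl, rfl, rfl, coord_mul_coordInv _ _, coordInv_mul_coord _ _,
      Or.inr ⟨h, i, rfl⟩⟩
  | add p q h i =>
    exact Or.inr ⟨p, q, h, Or.inl rfl, fun s t a a' hst ha ha' hsh =>
      commutingPairs_add h i hst ha ha' hsh⟩
  | neg p q h i =>
    exact Or.inr ⟨p, q, h, Or.inr rfl, fun s t a a' hst ha ha' hsh =>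
      commutingPairs_neg h i hst ha ha' hsh⟩

theorem LongShape.commutingPairs {v w : Fin r → ℤ}
    {X X' Y Y' : Matrix (Fin (2 * r + 1)) (Fin (2 * r + 1)) (CoordAlg N)}
    (hX : LongShape N v X X') (hY : LongShape N w Y Y') (hvw : v ⬝ᵥ w = 0)
    (heven : ∀ k, Even (v k + w k)) : CommutingPairs X X' Y Y' := by
  have hsupp : ∀ {p q s t : Fin r}, p ≠ q → s ≠ t →
      (∀ k, (v k = eps p k - eps q k ∨ v k = eps p k + eps q k ∨ v k = -eps p k - eps q k)) →
      (∀ k, (w k = eps s k - eps t k ∨ w k = eps s k + eps t k ∨ w k = -eps s k - eps t k)) →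
      (s = p ∧ t = q) ∨ (s = q ∧ t = p) := by
    intro p q s t hpq hst hv hw
    refine same_support hpq hst fun k => ?_
    -- Passing from `v` and `w` to the unsigned sum changes each coordinate by an even number.
    have h1 := heven k
    have h2 := hv k
    have h3 := hw k
    rw [Int.even_iff] at h1 ⊢
    omega
  rcases hX.exists_support with ⟨p, q, a, a', hpq, rfl, rfl, rfl, ha, ha', hsh⟩ |
      ⟨p, q, hpq, hv, hX'⟩ <;>
    rcases hY.exists_support with ⟨s, t, b, b', hst, rfl, rfl, rfl, hb, hb', hsh'⟩ |
      ⟨s, t, hst, hw, hY'⟩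
  -- Two differences with the same support are equal or opposite, hence not orthogonal.
  · exfalso
    rcases hsupp hpq hst (fun k => Or.inl rfl) (fun k => Or.inl rfl) with ⟨rfl, rfl⟩ | ⟨rfl, rfl⟩ <;>
      simp [eps_dot, hpq, hpq.symm] at hvw
  · refine hY' p q a a' ?_ ha ha' hsh
    have := hsupp hpq hst.ne (fun k => Or.inl rfl)
      (fun k => by rcases hw with rfl | rfl <;> simp)
    tauto
  · refine (hX' s t b b' ?_ hb hb' hsh').symm
    exact hsupp hpq.ne hst (fun k => by rcases hv with rfl | rfl <;> simp) (fun k => Or.inl rfl)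
  -- Two signed sums with the same support are equal or opposite as well; the transposed matching
  -- contradicts `p < q` and `s < t`.
  · exfalso
    rcases hsupp hpq.ne hst.ne (fun k => by rcases hv with rfl | rfl <;> simp)
      (fun k => by rcases hw with rfl | rfl <;> simp) with ⟨rfl, rfl⟩ | ⟨rfl, rfl⟩
    · rcases hv with rfl | rfl <;> rcases hw with rfl | rfl <;>
        simp [eps_dot, hpq.ne, hpq.ne'] at hvw
    · exact hpq.not_gt hst

theorem commutingPairs_of_orthogonal (i j : Idx r N)
    (h : rootOf r N i ⬝ᵥ rootOf r N j = 0) :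
    CommutingPairs (eImg N i) (fImg N i) (eImg N j) (fImg N j) := by
  have hadd := add_dot_self (rootOf r N i) (rootOf r N j)
  have hsub := sub_dot_self (rootOf r N i) (rootOf r N j)
  have hgen : NonRoot (rootOf r N i + rootOf r N j) → NonRoot (rootOf r N i - rootOf r N j) →
      CommutingPairs (eImg N i) (fImg N i) (eImg N j) (fImg N j) :=
    commutingPairs_of_nonRoot (eImg_mem_rootSpace i) (fImg_mem_rootSpace i)
      (eImg_mem_rootSpace j) (fImg_mem_rootSpace j)
  rw [h] at hadd hsub
  rcases rootOf_dot_self r N i with hi | hi <;> rcases rootOf_dot_self r N j with hj | hj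
  · obtain rfl := eq_of_short hi hj
    omega
  · exact hgen (Or.inr (Or.inl (by omega))) (Or.inr (Or.inl (by omega)))
  · exact hgen (Or.inr (Or.inl (by omega))) (Or.inr (Or.inl (by omega)))
  -- Both roots are long, so sum and difference have squared length 4. They have the same parities,
  -- and an odd coordinate excludes `±2ε_k`.
  · by_cases heven : ∀ k, Even (rootOf r N i k + rootOf r N j k)
    · exact (longShape i hi).commutingPairs (longShape j hj) h heven
    · push Not at heven
      obtain ⟨k, hk⟩ := heven
      refine hgen (Or.inr (Or.inr ⟨by omega, k, ?_⟩)) (Or.inr (Or.inr ⟨by omega, k, ?_⟩))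
      · simpa using hk
      · rw [Int.not_even_iff] at hk ⊢
        simp only [Pi.sub_apply]
        omega

/-! ### The defining relations -/

theorem affMatrix_mul (i j : Idx r N) :
    affMatrix r N i j * (rootOf r N i ⬝ᵥ rootOf r N i) = 2 * (rootOf r N i ⬝ᵥ rootOf r N j) := by
  rw [affMatrix, Matrix.of_apply]
  rcases rootOf_dot_self r N i with h | h <;> rw [h] <;> omega

theorem lie_eImg_fImg_of_nonpos {i j : Idx r N} (hM : affMatrix r N i j ≤ 0) :
    ⁅eImg N i, fImg N j⁆ = 0 ∧ ⁅fImg N i, eImg N j⁆ = 0 := by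
  have hmul := affMatrix_mul i j
  rcases eq_or_ne (rootOf r N i ⬝ᵥ rootOf r N j) 0 with h0 | h0
  · have := commutingPairs_of_orthogonal i j h0
    exact ⟨this.2.1, this.2.2.1⟩
  -- The inner product is now at most -1 and at least one of the roots is long, so the squared
  -- length is at least `1 + 2 + 2 = 5`.
  have hroot : NonRoot (rootOf r N i - rootOf r N j) := by
    refine Or.inl ?_
    rw [sub_dot_self]
    rcases rootOf_dot_self r N i with hi | hi <;> rcases rootOf_dot_self r N j with hj | hj
    · obtain rfl := eq_of_short hi hj
      rw [hi] at hmul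
      omega
    all_goals rw [hi] at hmul; omega
  constructor
  · refine hroot.eq_zero (η := eta N) ?_
    rw [sub_eq_add_neg]
    exact lie_mem_rootSpace (eImg_mem_rootSpace i) (fImg_mem_rootSpace j)
  · refine hroot.neg.eq_zero (η := eta N) ?_
    rw [neg_sub, ← neg_add_eq_sub]
    exact lie_mem_rootSpace (fImg_mem_rootSpace i) (eImg_mem_rootSpace j)

theorem lie_eImg_eImg_of_pos {i j : Idx r N} (hM : 0 < affMatrix r N i j) (hij : i ≠ j) :
    ⁅eImg N i, eImg N j⁆ = 0 ∧ ⁅fImg N i, fImg N j⁆ = 0 := by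
  have hmul := affMatrix_mul i j
  have hroot : NonRoot (rootOf r N i + rootOf r N j) := by
    refine Or.inl ?_
    rw [add_dot_self]
    rcases rootOf_dot_self r N i with hi | hi <;> rcases rootOf_dot_self r N j with hj | hj
    · exact absurd (eq_of_short hi hj) hij
    all_goals rw [hi] at hmul; omega
  constructor
  · exact hroot.eq_zero (lie_mem_rootSpace (eImg_mem_rootSpace i) (eImg_mem_rootSpace j))
  · refine hroot.neg.eq_zero (η := eta N) ?_
    rw [neg_add]
    exact lie_mem_rootSpace (fImg_mem_rootSpace i) (fImg_mem_rootSpace j)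

/-- The vector lies one step beyond the reflection `mα + β` of `β` in `α`. Two short roots must be
excluded: for `β = -α` one has `m = 2`, and `3α - α = 2α` is a root of `BC_r`. -/
theorem nonRoot_reflection {i : Idx r N} {β : Fin r → ℤ} {m : ℕ} (hm : 0 < m)
    (hmul : m * (rootOf r N i ⬝ᵥ rootOf r N i) = -(2 * (rootOf r N i ⬝ᵥ β)))
    (hβ : (rootOf r N i ⬝ᵥ rootOf r N i = 1 ∧ β ⬝ᵥ β = 2) ∨
      (rootOf r N i ⬝ᵥ rootOf r N i = 2 ∧ (β ⬝ᵥ β = 1 ∨ β ⬝ᵥ β = 2))) :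
    NonRoot ((m + 1) • rootOf r N i + β) := by
  refine Or.inl ?_
  -- By `hmul` the cross term equals `-(m + 1) m (α, α)`, which leaves `(m + 1) (α, α)` of the
  -- quadratic part.
  have e : ((m + 1 : ℕ) : ℤ) ^ 2 * (rootOf r N i ⬝ᵥ rootOf r N i) +
      2 * (m + 1 : ℕ) * (rootOf r N i ⬝ᵥ β) + β ⬝ᵥ β =
      (m + 1) * (rootOf r N i ⬝ᵥ rootOf r N i) + β ⬝ᵥ β := by
    push_cast
    linear_combination (m + 1 : ℤ) * hmul
  rw [nsmul_add_dot_self, e]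
  -- If `α` is short then `m` is even, so `m ≥ 2` and the value is at least `3 + 2`; if `α` is long
  -- it is at least `2 * 2 + 1`.
  rcases hβ with ⟨h1, h2⟩ | ⟨h1, h2⟩ <;> rw [h1] at hmul ⊢ <;> omega

theorem ad_pow_of_nonpos {i j : Idx r N} (hM : affMatrix r N i j ≤ 0) :
    (LieAlgebra.ad ℂ (Matrix (Fin (2 * r + 1)) (Fin (2 * r + 1)) (CoordAlg N)) (eImg N i) ^
        ((-affMatrix r N i j).toNat + 1)) (eImg N j) = 0 ∧
      (LieAlgebra.ad ℂ (Matrix (Fin (2 * r + 1)) (Fin (2 * r + 1)) (CoordAlg N)) (fImg N i) ^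
        ((-affMatrix r N i j).toNat + 1)) (fImg N j) = 0 := by
  have hmul := affMatrix_mul i j
  rcases hM.eq_or_lt with h0 | hneg
  -- For a zero entry the exponent is 1, and the relation is plain commutation of orthogonal roots.
  · rw [h0] at hmul ⊢
    have := commutingPairs_of_orthogonal i j (by omega)
    exact ⟨by simpa using this.1, by simpa using this.2.2.2⟩
  obtain ⟨m, hm⟩ : ∃ m : ℕ, (m : ℤ) = -affMatrix r N i j :=
    ⟨(-affMatrix r N i j).toNat, by omega⟩
  rw [← hm, Int.toNat_natCast]
  have hroot : NonRoot ((m + 1) • rootOf r N i + rootOf r N j) := by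
    refine nonRoot_reflection (by omega) (by rw [hm]; linear_combination -hmul) ?_
    rcases rootOf_dot_self r N i with hi | hi <;> rcases rootOf_dot_self r N j with hj | hj
    · obtain rfl := eq_of_short hi hj
      rw [hi] at hmul
      omega
    all_goals simp [hi, hj]
  constructor
  · exact hroot.eq_zero (ad_pow_mem_rootSpace (eImg_mem_rootSpace i) (eImg_mem_rootSpace j) _)
  · refine hroot.neg.eq_zero (η := eta N) ?_
    rw [neg_add, ← smul_neg]
    exact ad_pow_mem_rootSpace (fImg_mem_rootSpace i) (fImg_mem_rootSpace j) _

theorem ad_pow_of_pos {i j : Idx r N} (hM : 0 < affMatrix r N i j) (hij : i ≠ j) :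
    (LieAlgebra.ad ℂ (Matrix (Fin (2 * r + 1)) (Fin (2 * r + 1)) (CoordAlg N)) (eImg N i) ^
        ((affMatrix r N i j).toNat + 1)) (fImg N j) = 0 ∧
      (LieAlgebra.ad ℂ (Matrix (Fin (2 * r + 1)) (Fin (2 * r + 1)) (CoordAlg N)) (fImg N i) ^
        ((affMatrix r N i j).toNat + 1)) (eImg N j) = 0 := by
  have hmul := affMatrix_mul i j
  obtain ⟨m, hm⟩ : ∃ m : ℕ, (m : ℤ) = affMatrix r N i j :=
    ⟨(affMatrix r N i j).toNat, by omega⟩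
  rw [← hm, Int.toNat_natCast]
  -- The same estimate is used with `β` the negative of the second root, which turns the positive
  -- entry into the required sign.
  have hroot : NonRoot ((m + 1) • rootOf r N i + -rootOf r N j) := by
    refine nonRoot_reflection (by omega)
      (by rw [hm, dotProduct_neg]; linear_combination hmul) ?_
    rcases rootOf_dot_self r N i with hi | hi <;> rcases rootOf_dot_self r N j with hj | hj
    · exact absurd (eq_of_short hi hj) hij
    all_goals simp [hi, hj]
  constructor
  · exact hroot.eq_zero (ad_pow_mem_rootSpace (eImg_mem_rootSpace i) (fImg_mem_rootSpace j) _)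
  · refine hroot.neg.eq_zero (η := eta N) ?_
    rw [neg_add, neg_neg, ← smul_neg]
    exact ad_pow_mem_rootSpace (fImg_mem_rootSpace i) (eImg_mem_rootSpace j) _

/-! ### Construction of the homomorphism -/

/-- The images of the generators as elements of `so_{2r+1}(𝔟, η, 0, 0)`. -/
def genImg (N : LongRoot r → ℕ) : GimGen (Idx r N) → so r (eta N)
  | .e i => ⟨eImg N i, rootSpace_le_so (rootOf_mem_rootsBC i) (eImg_mem_rootSpace i)⟩
  | .f i => ⟨fImg N i,
      rootSpace_le_so (neg_mem_rootsBC (rootOf_mem_rootsBC i)) (fImg_mem_rootSpace i)⟩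
  | .h i => ⟨hImg N i, hImg_mem_so i⟩

theorem lift_genImg_of_gimRel {x : FreeLieAlgebra ℂ (GimGen (Idx r N))}
    (hx : GimRel (affMatrix r N) x) : FreeLieAlgebra.lift ℂ (genImg N) x = 0 := by
  -- The inclusion into matrices is injective, so the relations may be checked in the matrix
  -- algebra.
  set ψ := ((so r (eta N)).incl).comp (FreeLieAlgebra.lift ℂ (genImg N)) with hψ
  have hE : ∀ i, ψ (GimGen.E i) = eImg N i := fun i => by
    simp [hψ, GimGen.E, FreeLieAlgebra.lift_of_apply, genImg]
  have hF : ∀ i, ψ (GimGen.F i) = fImg N i := fun i => by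
    simp [hψ, GimGen.F, FreeLieAlgebra.lift_of_apply, genImg]
  have hH : ∀ i, ψ (GimGen.H i) = hImg N i := fun i => by
    simp [hψ, GimGen.H, FreeLieAlgebra.lift_of_apply, genImg]
  suffices h : ψ x = 0 from Subtype.ext h
  cases hx with
  | he i j => rw [map_sub, LieHom.map_lie, map_zsmul, hH, hE, (lie_hImg i j).1, sub_self]
  | hf i j => rw [map_add, LieHom.map_lie, map_zsmul, hH, hF, (lie_hImg i j).2, neg_add_cancel]
  | ef i => rw [map_sub, LieHom.map_lie, hE, hF, hH, lie_eImg_fImg, sub_self]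
  | nonpos_ef i j hM => rw [LieHom.map_lie, hE, hF, (lie_eImg_fImg_of_nonpos hM).1]
  | nonpos_fe i j hM => rw [LieHom.map_lie, hE, hF, (lie_eImg_fImg_of_nonpos hM).2]
  | nonpos_ad_e i j hM => rw [lieHom_ad_pow, hE, hE, (ad_pow_of_nonpos hM).1]
  | nonpos_ad_f i j hM => rw [lieHom_ad_pow, hF, hF, (ad_pow_of_nonpos hM).2]
  | pos_ee i j hM hij => rw [LieHom.map_lie, hE, hE, (lie_eImg_eImg_of_pos hM hij).1]
  | pos_ff i j hM hij => rw [LieHom.map_lie, hF, hF, (lie_eImg_eImg_of_pos hM hij).2]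
  | pos_ad_e i j hM hij => rw [lieHom_ad_pow, hE, hF, (ad_pow_of_pos hM hij).1]
  | pos_ad_f i j hM hij => rw [lieHom_ad_pow, hE, hF, (ad_pow_of_pos hM hij).2]

theorem gimIdeal_le_ker_lift_genImg :
    gimIdeal (affMatrix r N) ≤ (FreeLieAlgebra.lift ℂ (genImg N)).ker :=
  LieSubmodule.lieSpan_le.2 fun _ hx => (LieHom.mem_ker).2 (lift_genImg_of_gimRel hx)

/-- The homomorphism `gim(A^[d]) → so_{2r+1}(𝔟, η, 0, 0)`. -/
def gimToSo (N : LongRoot r → ℕ) : gim (affMatrix r N) →ₗ⁅ℂ⁆ so r (eta N) :=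
  quotientLift _ (FreeLieAlgebra.lift ℂ (genImg N)) fun _ hx =>
    (LieHom.mem_ker).1 (gimIdeal_le_ker_lift_genImg hx)

theorem gimToSo_gimOf (g : GimGen (Idx r N)) : gimToSo N (gimOf _ g) = genImg N g := by
  rw [gimToSo, gimOf, quotientLift_mk, FreeLieAlgebra.lift_of_apply]

end

end GimB

theorem theorem3 (r : ℕ) (hr : 3 ≤ r) (N : GimB.LongRoot r → ℕ) :
    ∃! φ : GimB.gim (GimB.affMatrix r N) →ₗ⁅ℂ⁆ GimB.so r (GimB.eta N),
      ∀ i : GimB.Idx r N,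
        (φ (GimB.gimOf _ (GimB.GimGen.e i)) : Matrix (Fin (2 * r + 1)) (Fin (2 * r + 1))
          (GimB.CoordAlg N)) = GimB.eImg N i ∧
        (φ (GimB.gimOf _ (GimB.GimGen.f i)) : Matrix (Fin (2 * r + 1)) (Fin (2 * r + 1))
          (GimB.CoordAlg N)) = GimB.fImg N i ∧
        (φ (GimB.gimOf _ (GimB.GimGen.h i)) : Matrix (Fin (2 * r + 1)) (Fin (2 * r + 1))
          (GimB.CoordAlg N)) = GimB.hImg N i := by
  refine ⟨GimB.gimToSo N, fun i => ?_, fun ψ hψ => GimB.gim_hom_ext fun g => Subtype.ext ?_⟩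
  · simp only [GimB.gimToSo_gimOf]
    exact ⟨rfl, rfl, rfl⟩
  · rw [GimB.gimToSo_gimOf]
    cases g with
    | e i => exact (hψ i).1
    | f i => exact (hψ i).2.1
    | h i => exact (hψ i).2.2
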